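/- Let $p\ge 1$ be an integer, and let $\mathcal E_p=\{(z_1,z_2)\in\mathbb C^2:|z_1|^{2p}+|z_2|^{2p}<1\}$, with boundary $b\mathcal E_p$. Let $\sigma$ be the Euclidean surface area measure on $b\mathcal E_p$, and let $\omega_p=j^*(d^c\varphi_p\wedge dd^c\varphi_p)$ be the Monge–Ampère boundary measure of $\varphi_p(z)=\frac1{2p}\log(|z_1|^{2p}+|z_2|^{2p})$, where $d^c=i(\bar\partial-\partial)$ and $j:b\mathcal E_p\to\mathbb C^2$ is the inclusion. For $\nu\in\{\sigma,\omega_p\}$, let $\mathfrak H^2(\mathcal E_p,\nu)$ be the closure in $L^2(\nu)$ of the set of restrictions $F|_{\operatorname{supp}\nu}$ of functions $F$ that are holomorphic on $\mathcal E_p$ and continuous on $\mathcal E_p\cup\operatorname{supp}\nu$. Use coordinates $(s,\theta_1,\theta_2)\in(0,1)\times[0,2\pi)^2$ on $b\mathcal E_p\setminus\{z_1z_2=0\}$, given by $(z_1,z_2)=\big(s^{1/2p}e^{i\theta_1},(1-s)^{1/2p}e^{i\theta_2}\big)$; the omitted set is null for both measures. Let $\beta(x,y)=\int_0^1 s^{x-1}(1-s)^{y-1}\,ds$.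 Then $$\mathfrak H^2(\mathcal E_p,\sigma)=\Big\{\sum_{j,\ell\ge0}a_{j,\ell}\,s^{\frac j{2p}}(1-s)^{\frac\ell{2p}}e^{i(j\theta_1+\ell\theta_2)}:\ \sum_{j,\ell\ge0}|a_{j,\ell}|^2\,\beta\big(\tfrac{j+1}p,\tfrac{\ell+1}p\big)<\infty\Big\},$$ $$\mathfrak H^2(\mathcal E_p,\omega_p)=\Big\{\sum_{j,\ell\ge0}a_{j,\ell}\,s^{\frac j{2p}}(1-s)^{\frac\ell{2p}}e^{i(j\theta_1+\ell\theta_2)}:\ \sum_{j,\ell\ge0}|a_{j,\ell}|^2\,\beta\big(\tfrac jp+1,\tfrac\ell p+1\big)<\infty\Big\},$$ where, for every such family of complex coefficients $(a_{j,\ell})$, the series converges (unconditionally) in $L^2(\sigma)$, respectively $L^2(\omega_p)$. The measures $\sigma$ and $\omega_p$ have the same null sets, and, as spaces of functions on $b\mathcal E_p$ modulo null sets, $\mathfrak H^2(\mathcal E_1,\sigma)=\mathfrak H^2(\mathcal E_1,\omega_1)$, while $\mathfrak H^2(\mathcal E_p,\sigma)\subsetneq\mathfrak H^2(\mathcal E_p,\omega_p)$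 when $p>1$. -/

import Mathlib

open MeasureTheory Filter Topology
open scoped ENNReal

/-- The space `ℂ²` with its Euclidean metric; coordinates `z 0`, `z 1` stand for `z₁`, `z₂`. -/
abbrev C2 : Type := EuclideanSpace ℂ (Fin 2)

noncomputable section

/-! ### Hardy spaces of a domain with a boundary measure -/

/-- `𝒜(Ω, ν) = 𝒪(Ω) ∩ 𝒞(Ω ∪ supp ν)`. Functions are total on `ℂ²`; only their values on
`Ω ∪ supp ν` matter. -/
def algA (Ω : Set C2) (ν : Measure C2) : Set (C2 → ℂ) :=
  {F | DifferentiableOn ℂ F Ω ∧ ContinuousOn F (Ω ∪ ν.support)}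

/-- `𝔥²(Ω, ν)`: the closure in `L²(ν)` of the restrictions to `supp ν` of functions in
`𝒜(Ω, ν)` (the complement of `supp ν` is `ν`-null). -/
def hardySpace (Ω : Set C2) (ν : Measure C2) : Set (Lp ℂ 2 ν) :=
  closure {f | ∃ F ∈ algA Ω ν, f =ᵐ[ν] F}

/-- The functions whose class modulo `ν`-null sets belongs to `𝔥²(Ω, ν)`. -/
def hardyFunctions (Ω : Set C2) (ν : Measure C2) : Set (C2 → ℂ) :=
  {f | ∃ hf : MemLp f 2 ν, hf.toLp f ∈ hardySpace Ω ν}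

/-! ### Surface measure and Monge–Ampère boundary measure -/

/-- Euclidean surface area on the boundary of a domain in `ℂ² = ℝ⁴`: three-dimensional Hausdorff
measure, normalized to agree with Lebesgue measure on three-dimensional subspaces. -/
def surfaceMeasure (Ω : Set C2) : Measure C2 :=
  (μHE[3] : Measure C2).restrict (frontier Ω)

/-- The `1`-form `dᶜφ = i(∂̄φ - ∂φ)`. Since `∂φ(v) = (dφ(v) - i dφ(iv)) / 2` and
`∂̄φ(v) = (dφ(v) + i dφ(iv)) / 2`, it is `dᶜφ(v) = -dφ(iv)`. -/
def dc (φ : C2 → ℝ) (z : C2) : C2 [⋀^Fin 1]→L[ℝ] ℝ :=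
  ContinuousAlternatingMap.ofSubsingleton ℝ C2 ℝ 0
    (-(fderiv ℝ φ z).comp ((Complex.I • ContinuousLinearMap.id ℂ C2).restrictScalars ℝ))

/-- The `2`-form `ddᶜφ`. -/
def ddc (φ : C2 → ℝ) (z : C2) : C2 [⋀^Fin 2]→L[ℝ] ℝ := extDeriv (dc φ) z

/-- The `3`-form `dᶜφ ∧ ddᶜφ`, evaluated on three tangent vectors. -/
def dcWedgeDdc (φ : C2 → ℝ) (z u v w : C2) : ℝ :=
  dc φ z ![u] * ddc φ z ![v, w] - dc φ z ![v] * ddc φ z ![u, w] + dc φ z ![w] * ddc φ z ![u, v]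

/-- The Euclidean gradient of `φ` as a vector of `ℂ²`: its `j`-th entry is
`∂φ/∂xⱼ + i ∂φ/∂yⱼ`, where `zⱼ = xⱼ + i yⱼ`. -/
def realGrad (φ : C2 → ℝ) (z : C2) : C2 :=
  WithLp.toLp 2 fun j =>
    (fderiv ℝ φ z (EuclideanSpace.single j 1) : ℂ)
      + Complex.I * (fderiv ℝ φ z (EuclideanSpace.single j Complex.I) : ℂ)

/-- The unit vector in the direction of the gradient: the outer unit normal of `{φ < 0}`. -/
def unitNormal (φ : C2 → ℝ) (z : C2) : C2 :=
  (‖realGrad φ z‖⁻¹ : ℝ) • realGrad φ z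

/-- For a unit vector `n`, a unit vector spanning the complex-orthogonal complement of `n`.
Thus `(n, i n, m, i m)` is a positively oriented orthonormal basis of `ℝ⁴`. -/
def complexTangent (n : C2) : C2 := !₂[-(starRingEnd ℂ) (n 1), (starRingEnd ℂ) (n 0)]

/-- The Monge–Ampère boundary measure `j^*(dᶜφ ∧ ddᶜφ)` of `Ω = {φ < 0}`, where
`j : bΩ → ℂ²` is the inclusion: the measure on `bΩ` whose density with respect to surface area is
the value of the `3`-form on the oriented orthonormal frame `(i n, m, i m)` of the tangent space,
with `n` the outer unit normal. -/
def mongeAmpereMeasure (Ω : Set C2) (φ : C2 → ℝ) : Measure C2 :=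
  (surfaceMeasure Ω).withDensity fun z =>
    ENNReal.ofReal
      (dcWedgeDdc φ z
        (Complex.I • unitNormal φ z)
        (complexTangent (unitNormal φ z))
        (Complex.I • complexTangent (unitNormal φ z)))

/-! ### Egg domains -/

/-- `𝓔ₚ = {|z₁|^{2p} + |z₂|^{2p} < 1}`. -/
def egg (p : ℕ) : Set C2 := {z | ‖z 0‖ ^ (2 * p) + ‖z 1‖ ^ (2 * p) < 1}

/-- `φₚ(z) = (1 / 2p) log (|z₁|^{2p} + |z₂|^{2p})`. -/
def eggExhaustion (p : ℕ) (z : C2) : ℝ :=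
  1 / (2 * p) * Real.log (‖z 0‖ ^ (2 * p) + ‖z 1‖ ^ (2 * p))

/-- The surface measure `σ` on `b𝓔ₚ`. -/
def eggSigma (p : ℕ) : Measure C2 := surfaceMeasure (egg p)

/-- The Monge–Ampère boundary measure `ωₚ` on `b𝓔ₚ`. -/
def eggOmega (p : ℕ) : Measure C2 := mongeAmpereMeasure (egg p) (eggExhaustion p)

/-- The parametrization `ϑ(s, θ₁, θ₂) = (s^{1/2p} e^{iθ₁}, (1-s)^{1/2p} e^{iθ₂})` of
`b𝓔ₚ ∖ {z₁ z₂ = 0}`, for `(s, θ₁, θ₂) ∈ (0,1) × [0,2π)²`. -/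
def eggParam (p : ℕ) (q : ℝ × ℝ × ℝ) : C2 :=
  !₂[((q.1 ^ (1 / (2 * p : ℝ)) : ℝ) : ℂ) * Complex.exp (q.2.1 * Complex.I),
     (((1 - q.1) ^ (1 / (2 * p : ℝ)) : ℝ) : ℂ) * Complex.exp (q.2.2 * Complex.I)]

/-- The coordinates `(s, θ₁, θ₂)` of a point of `b𝓔ₚ`: `s = |z₁|^{2p}`, and `θ₁, θ₂ ∈ [0, 2π)` are
arguments of `z₁, z₂`. -/
def eggCoords (p : ℕ) (z : C2) : ℝ × ℝ × ℝ :=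
  (‖z 0‖ ^ (2 * p),
    toIcoMod Real.two_pi_pos 0 (Complex.arg (z 0)),
    toIcoMod Real.two_pi_pos 0 (Complex.arg (z 1)))

theorem toIcoMod_arg {r θ : ℝ} (hr : 0 < r) (hθ : θ ∈ Set.Ico 0 (2 * Real.pi)) :
    toIcoMod Real.two_pi_pos 0 (Complex.arg ((r : ℂ) * Complex.exp (θ * Complex.I))) = θ := by
  rw [Complex.exp_mul_I, Complex.arg_mul_cos_add_sin_mul_I_eq_toIocMod hr,
    ← self_sub_toIocDiv_zsmul, toIcoMod_sub_zsmul, toIcoMod_eq_self]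
  simpa using hθ

/-- `eggCoords` inverts the parametrization `eggParam`. -/
theorem eggCoords_eggParam {p : ℕ} (hp : 0 < p) {s θ₁ θ₂ : ℝ} (hs : s ∈ Set.Ioo (0 : ℝ) 1)
    (h₁ : θ₁ ∈ Set.Ico 0 (2 * Real.pi)) (h₂ : θ₂ ∈ Set.Ico 0 (2 * Real.pi)) :
    eggCoords p (eggParam p (s, θ₁, θ₂)) = (s, θ₁, θ₂) := by
  have hs' : 0 < 1 - s := by linarith [hs.2]
  have e : (s ^ (1 / (2 * p : ℝ))) ^ (2 * p) = s := by
    rw [← Real.rpow_natCast, ← Real.rpow_mul hs.1.le]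
    have : (1 / (2 * p : ℝ)) * ((2 * p : ℕ) : ℝ) = 1 := by
      push_cast
      field_simp
    rw [this, Real.rpow_one]
  unfold eggCoords eggParam
  refine Prod.ext ?_ (Prod.ext ?_ ?_)
  · simpa [Complex.norm_exp_ofReal_mul_I, abs_of_pos (Real.rpow_pos_of_pos hs.1 _)] using e
  · exact toIcoMod_arg (Real.rpow_pos_of_pos hs.1 _) h₁
  · exact toIcoMod_arg (Real.rpow_pos_of_pos hs' _) h₂

/-- The function `s^{j/2p} (1-s)^{ℓ/2p} e^{i(jθ₁ + ℓθ₂)}`, where `x = (j, ℓ)`. -/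
def eggTerm (p : ℕ) (x : ℕ × ℕ) (q : ℝ × ℝ × ℝ) : ℂ :=
  ((q.1 ^ ((x.1 : ℝ) / (2 * p)) * (1 - q.1) ^ ((x.2 : ℝ) / (2 * p)) : ℝ) : ℂ)
    * Complex.exp (Complex.I * (x.1 * q.2.1 + x.2 * q.2.2))

/-- `f = ∑_{j,ℓ ≥ 0} a_{j,ℓ} s^{j/2p} (1-s)^{ℓ/2p} e^{i(jθ₁ + ℓθ₂)}` on `b𝓔ₚ`, with
(unconditional) convergence of the series in `L²(ν)`. -/
def IsEggSeries (p : ℕ) (ν : Measure C2) (a : ℕ × ℕ → ℂ) (f : C2 → ℂ) : Prop :=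
  Tendsto (fun S : Finset (ℕ × ℕ) =>
      eLpNorm (fun z => f z - ∑ x ∈ S, a x * eggTerm p x (eggCoords p z)) 2 ν)
    atTop (𝓝 0)

/-- The Euler beta function `β(x, y) = ∫₀¹ s^{x-1} (1-s)^{y-1} ds`. -/
def eulerBeta (x y : ℝ) : ℝ := ∫ s in (0 : ℝ)..1, s ^ (x - 1) * (1 - s) ^ (y - 1)

/-- `∑ |a_{j,ℓ}|² β((j+1)/p, (ℓ+1)/p) < ∞`. -/
def SigmaSummable (p : ℕ) (a : ℕ × ℕ → ℂ) : Prop :=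
  Summable fun x : ℕ × ℕ =>
    ‖a x‖ ^ 2 * eulerBeta (((x.1 : ℝ) + 1) / p) (((x.2 : ℝ) + 1) / p)

/-- `∑ |a_{j,ℓ}|² β(j/p + 1, ℓ/p + 1) < ∞`. -/
def OmegaSummable (p : ℕ) (a : ℕ × ℕ → ℂ) : Prop :=
  Summable fun x : ℕ × ℕ =>
    ‖a x‖ ^ 2 * eulerBeta ((x.1 : ℝ) / p + 1) ((x.2 : ℝ) / p + 1)

end

/-!
Both `σ` and `ωₚ` are invariant under the torus action `(z₁, z₂) ↦ (u₁ z₁, u₂ z₂)`, so the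
monomials `z₁ʲ z₂ˡ` are orthogonal in `L²(σ)` and in `L²(ωₚ)`. They span a dense subspace of the
Hardy space, since dilations followed by partial sums of the power series approximate a function in
`A(𝓔ₚ)` uniformly on the closed egg. Hence each Hardy space consists of the series
`∑ a_{j,ℓ} z₁ʲ z₂ˡ` with `∑ |a_{j,ℓ}|² ‖z₁ʲ z₂ˡ‖² < ∞`.

Only the order of magnitude of the norms matters, so it suffices to know each measure up to a
bounded factor. The image of `σ` under `s = |z₁|^{2p}` is comparable with
`(s (1 - s))^{1/p - 1} ds`, as a Lipschitz parametrization of the part `s ≤ 2/3` and the swap of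
the coordinates show; and `ωₚ` is comparable with `|z₁ z₂|^{2(p-1)} σ`, of image `ds`. The moments
of these measures on `(0, 1)` are beta values. As the density `|z₁ z₂|^{2(p-1)}` is bounded, the
Hardy space of `σ` is contained in that of `ωₚ`; a family supported on `j = 0` shows that the
inclusion is strict for `p > 1`.
-/

noncomputable section

/-! ### Comparable measures -/

section Dominated

variable {α β : Type*} [MeasurableSpace α] [MeasurableSpace β] {μ ν ρ : Measure α}

/-- `μ ≤ C ν` for some finite constant `C`. -/
def DominatedBy (μ ν : Measure α) : Prop := ∃ C : NNReal, μ ≤ C • ν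

namespace DominatedBy

theorem of_le (h : μ ≤ ν) : DominatedBy μ ν := ⟨1, by rwa [one_smul]⟩

theorem trans (hμν : DominatedBy μ ν) (hνρ : DominatedBy ν ρ) : DominatedBy μ ρ := by
  obtain ⟨C, hC⟩ := hμν
  obtain ⟨D, hD⟩ := hνρ
  exact ⟨C * D, hC.trans (by rw [mul_smul]; gcongr)⟩

theorem add (hμ : DominatedBy μ ρ) (hν : DominatedBy ν ρ) : DominatedBy (μ + ν) ρ := by
  obtain ⟨C, hC⟩ := hμ
  obtain ⟨D, hD⟩ := hν
  exact ⟨C + D, by rw [add_smul]; exact add_le_add hC hD⟩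

theorem map (h : DominatedBy μ ν) {f : α → β} (hf : Measurable f) :
    DominatedBy (μ.map f) (ν.map f) := by
  obtain ⟨C, hC⟩ := h
  exact ⟨C, by rw [← Measure.map_smul]; exact Measure.map_mono hC hf⟩

theorem of_union_eq_univ {s t : Set α} (hst : s ∪ t = Set.univ)
    (hs : DominatedBy (μ.restrict s) (ν.restrict s))
    (ht : DominatedBy (μ.restrict t) (ν.restrict t)) : DominatedBy μ ν := by
  have hle : μ ≤ μ.restrict s + μ.restrict t := by
    simpa [hst] using Measure.restrict_union_le (μ := μ) s t
  exact (of_le hle).trans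
    ((hs.trans (of_le Measure.restrict_le_self)).add (ht.trans (of_le Measure.restrict_le_self)))

theorem withDensity (h : DominatedBy μ ν) (f : α → ℝ≥0∞) :
    DominatedBy (μ.withDensity f) (ν.withDensity f) := by
  obtain ⟨C, hC⟩ := h
  refine ⟨C, Measure.le_iff.2 fun s hs => ?_⟩
  change _ ≤ ((C : ℝ≥0∞) • ν.withDensity f) s
  rw [← withDensity_smul_measure, withDensity_apply _ hs,
    withDensity_apply _ hs]
  exact lintegral_mono' (Measure.restrict_mono le_rfl hC) le_rfl

theorem withDensity_of_le {f g : α → ℝ≥0∞} {C : NNReal} (h : ∀ᵐ x ∂μ, f x ≤ C * g x)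
    (hg : Measurable g) : DominatedBy (μ.withDensity f) (μ.withDensity g) :=
  ⟨C, (withDensity_mono h).trans (withDensity_smul _ hg).le⟩

theorem absolutelyContinuous (h : DominatedBy μ ν) : μ ≪ ν := by
  obtain ⟨C, hC⟩ := h
  exact hC.absolutelyContinuous.trans (Measure.smul_absolutelyContinuous (c := C))

theorem isFiniteMeasure (h : DominatedBy μ ν) [IsFiniteMeasure ν] : IsFiniteMeasure μ := by
  obtain ⟨C, hC⟩ := h
  exact isFiniteMeasure_of_le _ hC

theorem exists_integral_le (h : DominatedBy μ ν) :
    ∃ C : ℝ, ∀ f : α → ℝ, 0 ≤ᵐ[ν] f → Integrable f ν → ∫ x, f x ∂μ ≤ C * ∫ x, f x ∂ν := by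
  obtain ⟨C, hC⟩ := h
  refine ⟨C, fun f hf hfi => ?_⟩
  have hle := integral_mono_measure hC (Measure.ae_smul_measure hf C) (hfi.smul_measure_nnreal)
  rwa [integral_smul_nnreal_measure] at hle

end DominatedBy

/-- Each of `μ`, `ν` is at most a constant times the other. -/
def Comparable (μ ν : Measure α) : Prop := DominatedBy μ ν ∧ DominatedBy ν μ

namespace Comparable

theorem symm (h : Comparable μ ν) : Comparable ν μ := And.symm h

theorem trans (hμν : Comparable μ ν) (hνρ : Comparable ν ρ) : Comparable μ ρ :=
  ⟨hμν.1.trans hνρ.1, hνρ.2.trans hμν.2⟩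

theorem smul_left {c : NNReal} (hc : c ≠ 0) (μ : Measure α) : Comparable (c • μ) μ :=
  ⟨⟨c, le_rfl⟩, ⟨c⁻¹, by rw [smul_smul, inv_mul_cancel₀ hc, one_smul]⟩⟩

theorem map (h : Comparable μ ν) {f : α → β} (hf : Measurable f) :
    Comparable (μ.map f) (ν.map f) :=
  ⟨h.1.map hf, h.2.map hf⟩

theorem withDensity (h : Comparable μ ν) (f : α → ℝ≥0∞) :
    Comparable (μ.withDensity f) (ν.withDensity f) :=
  ⟨h.1.withDensity f, h.2.withDensity f⟩

theorem of_union_eq_univ {s t : Set α} (hst : s ∪ t = Set.univ)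
    (hs : Comparable (μ.restrict s) (ν.restrict s))
    (ht : Comparable (μ.restrict t) (ν.restrict t)) : Comparable μ ν :=
  ⟨.of_union_eq_univ hst hs.1 ht.1, .of_union_eq_univ hst hs.2 ht.2⟩

end Comparable

end Dominated

/-! ### Orthogonal families in a Hilbert space -/

section Orthogonal

variable {𝕜 ι E : Type*} [RCLike 𝕜] [NormedAddCommGroup E] [InnerProductSpace 𝕜 E] {e : ι → E}

theorem orthonormal_inv_norm_smul (horth : Pairwise fun i j => inner 𝕜 (e i) (e j) = 0)
    (hne : ∀ i, e i ≠ 0) : Orthonormal 𝕜 fun i => ((‖e i‖⁻¹ : ℝ) : 𝕜) • e i := by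
  refine ⟨fun i => ?_, fun i j hij => ?_⟩
  · rw [norm_smul, RCLike.norm_ofReal, abs_inv, abs_norm,
      inv_mul_cancel₀ (norm_ne_zero_iff.2 (hne i))]
  · have h : inner 𝕜 (e i) (e j) = 0 := horth hij
    simp [inner_smul_left, inner_smul_right, h]

theorem summable_smul_iff_of_orthogonal [CompleteSpace E]
    (horth : Pairwise fun i j => inner 𝕜 (e i) (e j) = 0) (hne : ∀ i, e i ≠ 0) (a : ι → 𝕜) :
    (Summable fun i => a i • e i) ↔ Summable fun i => ‖a i‖ ^ 2 * ‖e i‖ ^ 2 := by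
  have hu := orthonormal_inv_norm_smul horth hne
  have hcancel (i : ι) : a i * (‖e i‖ : 𝕜) * ((‖e i‖⁻¹ : ℝ) : 𝕜) = a i := by
    have h0 : (‖e i‖ : 𝕜) ≠ 0 := by simpa using hne i
    rw [RCLike.ofReal_inv, mul_assoc, mul_inv_cancel₀ h0, mul_one]
  simpa only [LinearIsometry.toSpanSingleton_apply, smul_smul, hcancel, norm_mul,
    RCLike.norm_ofReal, abs_norm, mul_pow] using
    hu.orthogonalFamily.summable_iff_norm_sq_summable fun i => a i * (‖e i‖ : 𝕜)

theorem exists_hasSum_smul_of_mem_closure_span [CompleteSpace E]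
    (horth : Pairwise fun i j => inner 𝕜 (e i) (e j) = 0) (hne : ∀ i, e i ≠ 0) {f : E}
    (hf : f ∈ closure (Submodule.span 𝕜 (Set.range e) : Set E)) :
    ∃ a : ι → 𝕜, HasSum (fun i => a i • e i) f := by
  have hu := orthonormal_inv_norm_smul horth hne
  have hspan : Submodule.span 𝕜 (Set.range e) ≤ ⨆ i, LinearMap.range
      (LinearIsometry.toSpanSingleton 𝕜 E (hu.1 i)).toLinearMap := by
    rw [Submodule.span_le]
    rintro _ ⟨i, rfl⟩
    have h0 : (‖e i‖ : 𝕜) ≠ 0 := by simpa using hne i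
    exact Submodule.mem_iSup_of_mem i ⟨(‖e i‖ : 𝕜), by simp [smul_smul, h0]⟩
  have hmem : f ∈ LinearMap.range hu.orthogonalFamily.linearIsometry.toLinearMap := by
    rw [hu.orthogonalFamily.range_linearIsometry]
    exact closure_mono hspan hf
  obtain ⟨w, rfl⟩ := hmem
  refine ⟨fun i => w i * ((‖e i‖⁻¹ : ℝ) : 𝕜), ?_⟩
  simpa only [LinearIsometry.toSpanSingleton_apply, smul_smul] using!
    hu.orthogonalFamily.hasSum_linearIsometry w

theorem closure_span_eq_of_orthogonal [CompleteSpace E]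
    (horth : Pairwise fun i j => inner 𝕜 (e i) (e j) = 0) (hne : ∀ i, e i ≠ 0) :
    closure (Submodule.span 𝕜 (Set.range e) : Set E) =
      {f | ∃ a : ι → 𝕜, HasSum (fun i => a i • e i) f} := by
  refine Set.Subset.antisymm
    (fun f hf => exists_hasSum_smul_of_mem_closure_span horth hne hf) ?_
  rintro f ⟨a, ha⟩
  exact mem_closure_of_tendsto ha <| Eventually.of_forall fun S =>
    Submodule.sum_mem _ fun i _ => Submodule.smul_mem _ _ <| Submodule.subset_span ⟨i, rfl⟩

theorem inner_eq_mul_of_hasSum_of_orthogonal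
    (horth : Pairwise fun i j => inner 𝕜 (e i) (e j) = 0) {a : ι → 𝕜} {f : E}
    (ha : HasSum (fun i => a i • e i) f) (i : ι) :
    inner 𝕜 (e i) f = a i * inner 𝕜 (e i) (e i) := by
  have hsingle : HasSum (fun j => innerSL 𝕜 (e i) (a j • e j)) (innerSL 𝕜 (e i) (a i • e i)) :=
    hasSum_single i fun j hj => by simp [horth hj.symm]
  simpa [inner_smul_right] using ((innerSL 𝕜 (e i)).hasSum ha).unique hsingle

theorem eq_of_hasSum_of_orthogonal (horth : Pairwise fun i j => inner 𝕜 (e i) (e j) = 0)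
    (hne : ∀ i, e i ≠ 0) {a b : ι → 𝕜} {f : E} (ha : HasSum (fun i => a i • e i) f)
    (hb : HasSum (fun i => b i • e i) f) : a = b :=
  funext fun i => mul_right_cancel₀ (inner_self_ne_zero.2 (hne i)) <|
    (inner_eq_mul_of_hasSum_of_orthogonal horth ha i).symm.trans
      (inner_eq_mul_of_hasSum_of_orthogonal horth hb i)

end Orthogonal

/-! ### Geometry of the egg -/

/-- The monomial `z₁^j z₂^ℓ`, where `x = (j, ℓ)`. -/
def coordMonomial (x : ℕ × ℕ) (z : C2) : ℂ := z 0 ^ x.1 * z 1 ^ x.2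

/-- The function `|z₁|^{2p} + |z₂|^{2p}`; the egg is its sublevel set `{eggRho p < 1}`. -/
def eggRho (p : ℕ) (z : C2) : ℝ := ‖z 0‖ ^ (2 * p) + ‖z 1‖ ^ (2 * p)

/-- The rotation `(z₁, z₂) ↦ (u₁ z₁, u₂ z₂)` of the two coordinates. -/
def torusRotation (u : Fin 2 → Circle) : C2 ≃ᵢ C2 :=
  (LinearIsometryEquiv.piLpCongrRight 2 fun i => rotation (u i)).toIsometryEquiv

/-- The exchange `(z₁, z₂) ↦ (z₂, z₁)` of the two coordinates. -/
def coordSwap : C2 ≃ᵢ C2 :=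
  (LinearIsometryEquiv.piLpCongrLeft 2 ℂ ℂ (Equiv.swap (0 : Fin 2) 1)).toIsometryEquiv

/-- The coordinate `s = |z₁|^{2p}` of a point of the boundary of the egg. -/
def radialCoord (p : ℕ) (z : C2) : ℝ := ‖z 0‖ ^ (2 * p)

theorem continuous_coordMonomial (x : ℕ × ℕ) : Continuous (coordMonomial x) := by
  unfold coordMonomial; fun_prop

theorem differentiable_coordMonomial (x : ℕ × ℕ) : Differentiable ℂ (coordMonomial x) := by
  unfold coordMonomial; fun_prop

theorem torusRotation_apply (u : Fin 2 → Circle) (z : C2) (i : Fin 2) :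
    torusRotation u z i = u i * z i := rfl

section Egg

variable {p : ℕ} {z : C2}

theorem continuous_eggRho (p : ℕ) : Continuous (eggRho p) := by
  unfold eggRho; fun_prop

theorem continuous_radialCoord (p : ℕ) : Continuous (radialCoord p) := by
  unfold radialCoord; fun_prop

theorem radialCoord_torusRotation (p : ℕ) (u : Fin 2 → Circle) (z : C2) :
    radialCoord p (torusRotation u z) = radialCoord p z := by
  simp [radialCoord, torusRotation_apply, Circle.norm_coe]

theorem eggRho_torusRotation (p : ℕ) (u : Fin 2 → Circle) (z : C2) :
    eggRho p (torusRotation u z) = eggRho p z := by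
  simp [eggRho, torusRotation_apply, Circle.norm_coe]

theorem eggRho_coordSwap (p : ℕ) (z : C2) : eggRho p (coordSwap z) = eggRho p z :=
  add_comm _ _

theorem isOpen_egg (p : ℕ) : IsOpen (egg p) :=
  isOpen_lt (continuous_eggRho p) continuous_const

theorem smul_mem_egg (hp : 0 < p) (hz : eggRho p z ≤ 1) {r : ℝ} (hr0 : 0 ≤ r) (hr1 : r < 1) :
    (r : ℂ) • z ∈ egg p := by
  have hsmul : eggRho p ((r : ℂ) • z) = r ^ (2 * p) * eggRho p z := by
    simp [eggRho, mul_pow, mul_add, abs_of_nonneg hr0]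
  calc eggRho p ((r : ℂ) • z) ≤ r ^ (2 * p) := by
        rw [hsmul]; exact mul_le_of_le_one_right (by positivity) hz
    _ < 1 := pow_lt_one₀ hr0 hr1 (by omega)

theorem closure_egg (hp : 0 < p) : closure (egg p) = {z | eggRho p z ≤ 1} := by
  refine Set.Subset.antisymm
    (closure_lt_subset_le (continuous_eggRho p) continuous_const) fun z hz => ?_
  have hlim : Tendsto (fun r : ℝ => (r : ℂ) • z) (𝓝[<] 1) (𝓝 z) := by
    have : Tendsto (fun r : ℝ => (r : ℂ) • z) (𝓝 1) (𝓝 (((1 : ℝ) : ℂ) • z)) :=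
      Continuous.tendsto (by fun_prop) 1
    simpa using this.mono_left nhdsWithin_le_nhds
  refine mem_closure_of_tendsto hlim ?_
  filter_upwards [Ioo_mem_nhdsLT one_pos] with r hr
  exact smul_mem_egg hp hz hr.1.le hr.2

theorem frontier_egg (hp : 0 < p) : frontier (egg p) = {z | eggRho p z = 1} := by
  rw [frontier, (isOpen_egg p).interior_eq, closure_egg hp]
  ext z
  exact ⟨fun h => le_antisymm h.1 (not_lt.1 h.2), fun h => ⟨h.le, h.not_lt⟩⟩

theorem radialCoord_le_one (hz : eggRho p z ≤ 1) : radialCoord p z ≤ 1 :=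
  (le_add_of_nonneg_right (by positivity)).trans hz

theorem one_sub_radialCoord (hz : eggRho p z = 1) : 1 - radialCoord p z = ‖z 1‖ ^ (2 * p) := by
  rw [← hz, eggRho, radialCoord, add_sub_cancel_left]

theorem norm_coord_le_one (hp : 0 < p) (hz : eggRho p z ≤ 1) (i : Fin 2) : ‖z i‖ ≤ 1 := by
  have h0 : ‖z 0‖ ^ (2 * p) ≤ 1 := radialCoord_le_one hz
  have h1 : ‖z 1‖ ^ (2 * p) ≤ 1 := radialCoord_le_one (z := coordSwap z) (eggRho_coordSwap p z ▸ hz)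
  have hpow : ‖z i‖ ^ (2 * p) ≤ 1 := by fin_cases i; exacts [h0, h1]
  exact (pow_le_one_iff_of_nonneg (norm_nonneg _) (by omega)).1 hpow

theorem isCompact_closure_egg (hp : 0 < p) : IsCompact (closure (egg p)) := by
  refine Metric.isCompact_of_isClosed_isBounded isClosed_closure ?_
  refine (Metric.isBounded_closedBall (x := (0 : C2)) (r := 2)).subset fun z hz => ?_
  rw [closure_egg hp] at hz
  rw [mem_closedBall_zero_iff, EuclideanSpace.norm_eq, Real.sqrt_le_left (by norm_num),
    Fin.sum_univ_two]
  linarith [pow_le_one₀ (n := 2) (norm_nonneg _) (norm_coord_le_one hp hz 0),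
    pow_le_one₀ (n := 2) (norm_nonneg _) (norm_coord_le_one hp hz 1)]

theorem isCompact_frontier_egg (hp : 0 < p) : IsCompact (frontier (egg p)) :=
  (isCompact_closure_egg hp).of_isClosed_subset isClosed_frontier frontier_subset_closure

theorem exp_mul_toIcoMod_arg (w : ℂ) (j : ℕ) :
    Complex.exp (Complex.I * (j * (toIcoMod Real.two_pi_pos 0 (Complex.arg w) : ℝ))) =
      Complex.exp (Complex.arg w * Complex.I) ^ j := by
  rw [← Complex.exp_nat_mul, ← self_sub_toIcoDiv_zsmul, Complex.exp_eq_exp_iff_exists_int]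
  refine ⟨-(j * toIcoDiv Real.two_pi_pos 0 (Complex.arg w)), ?_⟩
  simp only [zsmul_eq_mul]
  push_cast
  ring

theorem rpow_mul_exp_toIcoMod_arg (hp : 0 < p) (w : ℂ) (j : ℕ) :
    (((‖w‖ ^ (2 * p)) ^ ((j : ℝ) / (2 * p)) : ℝ) : ℂ) *
      Complex.exp (Complex.I * (j * (toIcoMod Real.two_pi_pos 0 (Complex.arg w) : ℝ))) =
      w ^ j := by
  have : (0 : ℝ) < p := by exact_mod_cast hp
  have hmod : (‖w‖ ^ (2 * p)) ^ ((j : ℝ) / (2 * p)) = ‖w‖ ^ j := by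
    rw [← Real.rpow_natCast_mul (norm_nonneg w), ← Real.rpow_natCast]
    congr 1
    push_cast
    field_simp
  rw [hmod, exp_mul_toIcoMod_arg, Complex.ofReal_pow, ← mul_pow, Complex.norm_mul_exp_arg_mul_I]

theorem eggTerm_eggCoords (hp : 0 < p) (hz : eggRho p z = 1) (x : ℕ × ℕ) :
    eggTerm p x (eggCoords p z) = coordMonomial x z := by
  unfold eggTerm eggCoords coordMonomial
  rw [← rpow_mul_exp_toIcoMod_arg hp (z 0) x.1, ← rpow_mul_exp_toIcoMod_arg hp (z 1) x.2,
    ← one_sub_radialCoord hz]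
  simp only [radialCoord, mul_add, Complex.exp_add]
  push_cast
  ring

end Egg

/-! ### Density of polynomials -/

/-- The `n`-th Fourier coefficient of `k` on the unit circle, `∫ e^{-inθ} k(e^{iθ}) dθ / 2π`.
For `k` holomorphic in the disc it is the `n`-th Taylor coefficient. -/
def circleCoeff (n : ℕ) (k : ℂ → ℂ) : ℂ := Real.circleAverage (fun w => w⁻¹ ^ n * k w) 0 1

section CircleCoeff

open Metric

variable {k g : ℂ → ℂ} {n : ℕ} {M : ℝ}

theorem circleCoeff_congr (h : Set.EqOn k g (sphere 0 1)) : circleCoeff n k = circleCoeff n g :=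
  Real.circleAverage_congr_sphere fun w hw => by
    rw [abs_one] at hw
    simp only [h hw]

theorem circleCoeff_const_mul (c : ℂ) : circleCoeff n (fun w => c * k w) = c * circleCoeff n k := by
  unfold circleCoeff
  rw [← smul_eq_mul, ← Real.circleAverage_fun_smul]
  simp only [smul_eq_mul, mul_left_comm]

theorem norm_circleCoeff_le (h : ∀ w ∈ sphere (0 : ℂ) 1, ‖k w‖ ≤ M) : ‖circleCoeff n k‖ ≤ M := by
  have hbound : ∀ θ ∈ Set.uIoc 0 (2 * Real.pi),
      ‖(circleMap 0 1 θ)⁻¹ ^ n * k (circleMap 0 1 θ)‖ ≤ M := fun θ _ => by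
    simpa using h _ (circleMap_mem_sphere 0 zero_le_one θ)
  have hle := intervalIntegral.norm_integral_le_of_norm_le_const hbound
  rw [sub_zero, abs_of_pos Real.two_pi_pos] at hle
  rw [circleCoeff, Real.circleAverage_def, norm_smul, norm_inv,
    Real.norm_of_nonneg Real.two_pi_pos.le]
  exact inv_mul_le_of_le_mul₀ Real.two_pi_pos.le ((norm_nonneg _).trans (h 1 (by simp)))
    (by linarith)

theorem continuous_circleMap_inv_pow (n : ℕ) : Continuous fun θ => (circleMap 0 1 θ)⁻¹ ^ n :=
  ((continuous_circleMap 0 1).inv₀ fun _ => circleMap_ne_center one_ne_zero).pow n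

theorem circleCoeff_sub_sum {ι : Type*} {s : Finset ι} {f : ι → ℂ → ℂ}
    (hk : Continuous fun θ => k (circleMap 0 1 θ))
    (hf : ∀ i ∈ s, Continuous fun θ => f i (circleMap 0 1 θ)) :
    circleCoeff n (fun w => k w - ∑ i ∈ s, f i w) =
      circleCoeff n k - ∑ i ∈ s, circleCoeff n (f i) := by
  have hint {f : ℂ → ℂ} (hf : Continuous fun θ => f (circleMap 0 1 θ)) :
      CircleIntegrable (fun w => w⁻¹ ^ n * f w) 0 1 :=
    ((continuous_circleMap_inv_pow n).mul hf).intervalIntegrable _ _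
  unfold circleCoeff
  rw [← Real.circleAverage_fun_sum fun i hi => hint (hf i hi),
    ← Real.circleAverage_fun_sub (hint hk) (CircleIntegrable.fun_sum _ fun i hi => hint (hf i hi))]
  simp only [mul_sub, Finset.mul_sum]

theorem hasSum_pow_mul_circleCoeff (hk : DiffContOnCl ℂ k (ball 0 1)) {w : ℂ} (hw : ‖w‖ < 1) :
    HasSum (fun n => w ^ n * circleCoeff n k) (k w) := by
  have hseries (n : ℕ) :
      (cauchyPowerSeries k 0 1 n fun _ => w) = w ^ n * circleCoeff n k := by
    rw [← circleCoeff_const_mul, circleCoeff,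
      Real.circleAverage_eq_circleIntegral one_ne_zero, cauchyPowerSeries_apply]
    congr 2
    funext z
    simp only [smul_eq_mul, div_eq_mul_inv, mul_pow, sub_zero]
    ring
  have hsum := (hk.hasFPowerSeriesOnBall (R := 1) one_pos).hasSum
    (y := w) (by simpa [enorm_eq_nnnorm, ← NNReal.coe_lt_one] using hw)
  simpa only [NNReal.coe_one, hseries, zero_add] using hsum

theorem circleCoeff_eq_iteratedDeriv (hk : DiffContOnCl ℂ k (ball 0 1)) :
    circleCoeff n k = iteratedDeriv n k 0 / n.factorial := by
  have hint : ∮ z in C(0, 1), (z - 0)⁻¹ • (z⁻¹ ^ n * k z) =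
      ∮ z in C(0, 1), (1 / (z - 0) ^ (n + 1)) • k z := by
    congr 1
    funext z
    simp only [smul_eq_mul, sub_zero, one_div, pow_succ', mul_inv, inv_pow, mul_assoc]
  rw [circleCoeff, Real.circleAverage_eq_circleIntegral one_ne_zero, hint,
    hk.circleIntegral_one_div_sub_center_pow_smul one_pos n, smul_smul, smul_eq_mul]
  field_simp [Complex.two_pi_I_ne_zero]

theorem iteratedDeriv_comp_mul_left (k : ℂ → ℂ) (a : ℂ) (n : ℕ) :
    iteratedDeriv n (fun w => k (a * w)) = fun w => a ^ n * iteratedDeriv n k (a * w) := by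
  induction n with
  | zero => simp
  | succ n ih =>
    funext w
    simp only [iteratedDeriv_succ, ih, deriv_const_mul_field, deriv_comp_mul_left, smul_eq_mul]
    ring

theorem circleCoeff_comp_mul_left {a : ℂ} (hk : DiffContOnCl ℂ (fun w => k (a * w)) (ball 0 1)) :
    circleCoeff n (fun w => k (a * w)) = a ^ n * (iteratedDeriv n k 0 / n.factorial) := by
  rw [circleCoeff_eq_iteratedDeriv hk, iteratedDeriv_comp_mul_left]
  simp only [mul_zero, mul_div_assoc]

theorem norm_sub_sum_pow_mul_circleCoeff_le (hk : DiffContOnCl ℂ k (ball 0 1))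
    (hM : ∀ w ∈ sphere (0 : ℂ) 1, ‖k w‖ ≤ M) {r : ℝ} (hr0 : 0 ≤ r) (hr1 : r < 1) (N : ℕ) :
    ‖k r - ∑ n ∈ Finset.range N, (r : ℂ) ^ n * circleCoeff n k‖ ≤ M * r ^ N / (1 - r) := by
  have hr : ‖(r : ℂ)‖ = r := by rw [Complex.norm_real, Real.norm_of_nonneg hr0]
  rw [norm_sub_rev]
  refine norm_sub_le_of_geometric_bound_of_hasSum hr1 (fun n => ?_)
    (hasSum_pow_mul_circleCoeff hk (hr.trans_lt hr1)) N
  rw [norm_mul, norm_pow, hr, mul_comm]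
  gcongr
  exact norm_circleCoeff_le hM

end CircleCoeff

section TorusCoeff

open Metric

variable {G : ℂ → ℂ → ℂ} {j l : ℕ} {M : ℝ}

/-- The Fourier coefficient of `G` on the torus with frequencies `j`, `l`. -/
def torusCoeff (j l : ℕ) (G : ℂ → ℂ → ℂ) : ℂ := circleCoeff j fun w => circleCoeff l (G w)

theorem continuous_circleCoeff (l : ℕ)
    (hG : Continuous fun q : ℝ × ℝ => G (circleMap 0 1 q.1) (circleMap 0 1 q.2)) :
    Continuous fun θ => circleCoeff l (G (circleMap 0 1 θ)) := by
  unfold circleCoeff Real.circleAverage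
  have hint : Continuous fun q : ℝ × ℝ =>
      (circleMap 0 1 q.2)⁻¹ ^ l * G (circleMap 0 1 q.1) (circleMap 0 1 q.2) :=
    ((continuous_circleMap_inv_pow l).comp continuous_snd).mul hG
  exact (intervalIntegral.continuous_parametric_intervalIntegral_of_continuous' hint _ _).const_smul
    _

theorem torusCoeff_flip
    (hG : Continuous fun q : ℝ × ℝ => G (circleMap 0 1 q.1) (circleMap 0 1 q.2)) :
    torusCoeff l j (fun v w => G w v) = torusCoeff j l G := by
  have hint : Continuous fun q : ℝ × ℝ => (circleMap 0 1 q.1)⁻¹ ^ l *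
      ((circleMap 0 1 q.2)⁻¹ ^ j * G (circleMap 0 1 q.2) (circleMap 0 1 q.1)) :=
    ((continuous_circleMap_inv_pow l).comp continuous_fst).mul
      (((continuous_circleMap_inv_pow j).comp continuous_snd).mul (hG.comp continuous_swap))
  have hswap := intervalIntegral_intervalIntegral_swap (a := 0) (b := 2 * Real.pi) (c := 0)
    (d := 2 * Real.pi) (F := fun s t => (circleMap 0 1 s)⁻¹ ^ l *
      ((circleMap 0 1 t)⁻¹ ^ j * G (circleMap 0 1 t) (circleMap 0 1 s)))
    ((hint.continuousOn.integrableOn_compact (isCompact_uIcc.prod isCompact_uIcc)).mono_set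
      (Set.prod_mono Set.uIoc_subset_uIcc Set.uIoc_subset_uIcc))
  simp only [torusCoeff, circleCoeff, Real.circleAverage_def, mul_smul_comm,
    intervalIntegral.integral_smul, ← intervalIntegral.integral_const_mul, hswap, mul_left_comm]

theorem norm_circleCoeff_sub_sum_torusCoeff_le {r : ℝ} (hr0 : 0 ≤ r) (hr1 : r < 1)
    (hG : Continuous fun q : ℝ × ℝ => G (circleMap 0 1 q.1) (circleMap 0 1 q.2))
    (hG₁ : ContinuousOn (fun w => G w r) (sphere 0 1))
    (hG₂ : ∀ w ∈ sphere (0 : ℂ) 1, DiffContOnCl ℂ (G w) (ball 0 1))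
    (hM : ∀ w ∈ sphere (0 : ℂ) 1, ∀ v ∈ sphere (0 : ℂ) 1, ‖G w v‖ ≤ M) (N : ℕ) :
    ‖circleCoeff j (fun w => G w r) - ∑ l ∈ Finset.range N, (r : ℂ) ^ l * torusCoeff j l G‖ ≤
      M * r ^ N / (1 - r) := by
  have hcoeff : circleCoeff j (fun w => G w r - ∑ l ∈ Finset.range N,
      (r : ℂ) ^ l * circleCoeff l (G w)) = circleCoeff j (fun w => G w r) -
        ∑ l ∈ Finset.range N, (r : ℂ) ^ l * torusCoeff j l G := by
    rw [circleCoeff_sub_sum (k := fun w => G w r)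
      (f := fun l w => (r : ℂ) ^ l * circleCoeff l (G w))
      (hG₁.comp_continuous (continuous_circleMap 0 1) (circleMap_mem_sphere 0 zero_le_one))
      fun l _ => (continuous_circleCoeff l hG).const_mul _]
    simp only [circleCoeff_const_mul, torusCoeff]
  rw [← hcoeff]
  exact norm_circleCoeff_le fun w hw =>
    norm_sub_sum_pow_mul_circleCoeff_le (hG₂ w hw) (hM w hw) hr0 hr1 N

theorem sum_range_pow_le_inv_one_sub {r : ℝ} (hr0 : 0 ≤ r) (hr1 : r < 1) (N : ℕ) :
    ∑ j ∈ Finset.range N, r ^ j ≤ (1 - r)⁻¹ := by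
  rw [← tsum_geometric_of_lt_one hr0 hr1]
  exact (summable_geometric_of_lt_one hr0 hr1).sum_le_tsum _ fun j _ => by positivity

/-- Cauchy's formula is applied in one variable at a time, the second one under the average over
the first. -/
theorem norm_sub_sum_pow_mul_torusCoeff_le {r : ℝ} (hr0 : 0 ≤ r) (hr1 : r < 1)
    (hG : Continuous fun q : ℝ × ℝ => G (circleMap 0 1 q.1) (circleMap 0 1 q.2))
    (hG₁ : DiffContOnCl ℂ (fun w => G w r) (ball 0 1))
    (hG₂ : ∀ w ∈ sphere (0 : ℂ) 1, DiffContOnCl ℂ (G w) (ball 0 1))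
    (hM : ∀ w ∈ sphere (0 : ℂ) 1, ∀ v ∈ closedBall (0 : ℂ) 1, ‖G w v‖ ≤ M) (N : ℕ) :
    ‖G r r - ∑ j ∈ Finset.range N, ∑ l ∈ Finset.range N, (r : ℂ) ^ (j + l) * torusCoeff j l G‖ ≤
      2 * M * r ^ N / (1 - r) ^ 2 := by
  have hr : ‖(r : ℂ)‖ = r := by rw [Complex.norm_real, Real.norm_of_nonneg hr0]
  have h1r : 0 < 1 - r := sub_pos.2 hr1
  have hM0 : 0 ≤ M := (norm_nonneg _).trans (hM 1 (by simp) 1 (by simp))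
  set δ : ℝ := M * r ^ N / (1 - r)
  have hδ : 0 ≤ δ := by positivity
  have hr_mem : (r : ℂ) ∈ closedBall (0 : ℂ) 1 := mem_closedBall_zero_iff.2 (hr.trans_le hr1.le)
  have houter : ‖G r r - ∑ j ∈ Finset.range N, (r : ℂ) ^ j * circleCoeff j fun w => G w r‖ ≤ δ :=
    norm_sub_sum_pow_mul_circleCoeff_le hG₁ (fun w hw => hM w hw r hr_mem) hr0 hr1 N
  have hinner (j : ℕ) : ‖(r : ℂ) ^ j * (circleCoeff j (fun w => G w r) -
      ∑ l ∈ Finset.range N, (r : ℂ) ^ l * torusCoeff j l G)‖ ≤ r ^ j * δ := by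
    rw [norm_mul, norm_pow, hr]
    gcongr
    exact norm_circleCoeff_sub_sum_torusCoeff_le hr0 hr1 hG
      (hG₁.continuousOn_ball.mono sphere_subset_closedBall) hG₂
      (fun w hw v hv => hM w hw v (sphere_subset_closedBall hv)) N
  have hsplit : G r r - ∑ j ∈ Finset.range N, ∑ l ∈ Finset.range N,
        (r : ℂ) ^ (j + l) * torusCoeff j l G =
      (G r r - ∑ j ∈ Finset.range N, (r : ℂ) ^ j * circleCoeff j fun w => G w r) +
      ∑ j ∈ Finset.range N, (r : ℂ) ^ j * (circleCoeff j (fun w => G w r) -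
        ∑ l ∈ Finset.range N, (r : ℂ) ^ l * torusCoeff j l G) := by
    simp only [mul_sub, Finset.sum_sub_distrib, Finset.mul_sum, pow_add, mul_assoc]
    ring
  calc _ ≤ δ + ∑ j ∈ Finset.range N, r ^ j * δ :=
        hsplit ▸ (norm_add_le _ _).trans
          (add_le_add houter (norm_sum_le_of_le _ fun j _ => hinner j))
    _ ≤ (1 - r)⁻¹ * δ + (1 - r)⁻¹ * δ := by
        rw [← Finset.sum_mul]
        gcongr
        · exact le_mul_of_one_le_left hδ ((one_le_inv₀ h1r).2 (by linarith))
        · exact sum_range_pow_le_inv_one_sub hr0 hr1 N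
    _ = 2 * M * r ^ N / (1 - r) ^ 2 := by
        simp only [δ]
        field_simp
        ring

end TorusCoeff

/-- The pullback of `F` along the map `(w, v) ↦ (w z₁, v z₂)` of the bidisc. -/
def bidiscPullback (F : C2 → ℂ) (z : C2) (w v : ℂ) : ℂ := F !₂[z 0 * w, z 1 * v]

section BidiscPullback

open Metric

variable {p : ℕ} {F : C2 → ℂ} {z : C2}

theorem bidiscPullback_coordSwap (F : C2 → ℂ) (z : C2) (w v : ℂ) :
    bidiscPullback (F ∘ coordSwap) (coordSwap z) v w = bidiscPullback F z w v :=
  congrArg F (by ext i; fin_cases i <;> rfl)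

theorem bidiscPullback_self (F : C2 → ℂ) (z : C2) (w : ℂ) :
    bidiscPullback F z w w = F (w • z) :=
  congrArg F (by ext i; fin_cases i <;> simp [mul_comm])

theorem eggRho_toLp (p : ℕ) (a b : ℂ) : eggRho p !₂[a, b] = ‖a‖ ^ (2 * p) + ‖b‖ ^ (2 * p) :=
  rfl

theorem eggRho_bidisc_le (hz : eggRho p z ≤ 1) {w v : ℂ} (hw : ‖w‖ ≤ 1) (hv : ‖v‖ ≤ 1) :
    eggRho p !₂[z 0 * w, z 1 * v] ≤ 1 := by
  refine le_trans ?_ hz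
  rw [eggRho_toLp, eggRho, norm_mul, norm_mul]
  gcongr
  exacts [mul_le_of_le_one_right (norm_nonneg _) hw, mul_le_of_le_one_right (norm_nonneg _) hv]

theorem eggRho_bidisc_lt (hp : 0 < p) (hz : eggRho p z ≤ 1) (hz1 : z 1 ≠ 0) {w v : ℂ}
    (hw : ‖w‖ ≤ 1) (hv : ‖v‖ < 1) : eggRho p !₂[z 0 * w, z 1 * v] < 1 := by
  refine lt_of_lt_of_le ?_ hz
  rw [eggRho_toLp, eggRho, norm_mul, norm_mul]
  have h0 : ‖z 0‖ * ‖w‖ ≤ ‖z 0‖ := mul_le_of_le_one_right (norm_nonneg _) hw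
  have h1 : ‖z 1‖ * ‖v‖ < ‖z 1‖ := mul_lt_of_lt_one_right (norm_pos_iff.2 hz1) hv
  exact add_lt_add_of_le_of_lt (by gcongr) (pow_lt_pow_left₀ h1 (by positivity) (by omega))

theorem diffContOnCl_comp_coordSwap (hF : DiffContOnCl ℂ F (egg p)) :
    DiffContOnCl ℂ (F ∘ coordSwap) (egg p) :=
  hF.comp
    (LinearIsometryEquiv.piLpCongrLeft 2 ℂ ℂ (Equiv.swap (0 : Fin 2) 1)).differentiable.diffContOnCl
    fun z hz => (eggRho_coordSwap p z).trans_lt hz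

theorem continuous_torus_bidiscPullback (hp : 0 < p) (hF : DiffContOnCl ℂ F (egg p))
    (hz : eggRho p z ≤ 1) : Continuous fun q : ℝ × ℝ =>
      bidiscPullback F z (circleMap 0 1 q.1) (circleMap 0 1 q.2) := by
  refine hF.continuousOn.comp_continuous (by fun_prop) fun q => ?_
  rw [closure_egg hp]
  exact eggRho_bidisc_le hz (by simp) (by simp)

theorem diffContOnCl_bidiscPullback_snd (hp : 0 < p) (hF : DiffContOnCl ℂ F (egg p))
    (hz : eggRho p z ≤ 1) {w : ℂ} (hw : ‖w‖ ≤ 1) :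
    DiffContOnCl ℂ (bidiscPullback F z w) (ball 0 1) := by
  unfold bidiscPullback
  by_cases hz1 : z 1 = 0
  · simpa only [hz1, zero_mul] using diffContOnCl_const
  · have hdiff : Differentiable ℂ fun v : ℂ => (!₂[z 0 * w, z 1 * v] : C2) :=
      differentiable_euclidean.2 fun i => by
        fin_cases i
        exacts [differentiable_const _, differentiable_id.const_mul _]
    exact hF.comp hdiff.diffContOnCl fun v hv =>
      eggRho_bidisc_lt hp hz hz1 hw (mem_ball_zero_iff.1 hv)

theorem diffContOnCl_bidiscPullback_fst (hp : 0 < p) (hF : DiffContOnCl ℂ F (egg p))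
    (hz : eggRho p z ≤ 1) {v : ℂ} (hv : ‖v‖ ≤ 1) :
    DiffContOnCl ℂ (fun w => bidiscPullback F z w v) (ball 0 1) := by
  simp only [← bidiscPullback_coordSwap F z]
  exact diffContOnCl_bidiscPullback_snd hp (diffContOnCl_comp_coordSwap hF)
    ((eggRho_coordSwap p z).trans_le hz) hv

theorem torusCoeff_bidiscPullback_mul_pow_snd (hp : 0 < p) (hF : DiffContOnCl ℂ F (egg p))
    (hz : eggRho p z ≤ 1) {y : C2} (hy : eggRho p y ≤ 1) (h : z 0 = y 0) (j l : ℕ) :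
    torusCoeff j l (bidiscPullback F z) * y 1 ^ l =
      torusCoeff j l (bidiscPullback F y) * z 1 ^ l := by
  have key {x : C2} (hx : eggRho p x ≤ 1) : torusCoeff j l (bidiscPullback F x) =
      x 1 ^ l * circleCoeff j fun w =>
        iteratedDeriv l (fun v => F !₂[x 0 * w, v]) 0 / l.factorial := by
    rw [← circleCoeff_const_mul]
    refine circleCoeff_congr fun w hw => ?_
    exact circleCoeff_comp_mul_left (k := fun v => F !₂[x 0 * w, v])
      (diffContOnCl_bidiscPullback_snd hp hF hx (mem_sphere_zero_iff_norm.1 hw).le)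
  rw [key hz, key hy, h]
  ring

theorem torusCoeff_bidiscPullback_mul_pow_fst (hp : 0 < p) (hF : DiffContOnCl ℂ F (egg p))
    (hz : eggRho p z ≤ 1) {y : C2} (hy : eggRho p y ≤ 1) (h : z 1 = y 1) (j l : ℕ) :
    torusCoeff j l (bidiscPullback F z) * y 0 ^ j =
      torusCoeff j l (bidiscPullback F y) * z 0 ^ j := by
  have hflip {x : C2} (hx : eggRho p x ≤ 1) :
      torusCoeff l j (bidiscPullback (F ∘ coordSwap) (coordSwap x)) =
        torusCoeff j l (bidiscPullback F x) := by
    rw [← torusCoeff_flip (continuous_torus_bidiscPullback hp hF hx)]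
    simp only [torusCoeff, ← bidiscPullback_coordSwap F x]
  rw [← hflip hz, ← hflip hy]
  exact torusCoeff_bidiscPullback_mul_pow_snd hp (diffContOnCl_comp_coordSwap hF)
    ((eggRho_coordSwap p z).trans_le hz) ((eggRho_coordSwap p y).trans_le hy) h l j

/-- Any two points of the closed egg with nonzero coordinates can be compared through a third one
sharing a coordinate with each of them; the reference point is `(1/2, 1/2)`. -/
theorem exists_torusCoeff_bidiscPullback_eq (hp : 0 < p) (hF : DiffContOnCl ℂ F (egg p))
    (x : ℕ × ℕ) : ∃ c : ℂ, ∀ z : C2, eggRho p z ≤ 1 →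
      torusCoeff x.1 x.2 (bidiscPullback F z) = c * coordMonomial x z := by
  obtain ⟨j, l⟩ := x
  set h : ℂ := 1 / 2
  have hh : h ≠ 0 := by norm_num [h]
  have hpow : ‖h‖ ^ (2 * p) ≤ 1 / 2 := by
    simpa [h] using pow_le_of_le_one (a := (2⁻¹ : ℝ)) (by norm_num) (by norm_num)
      (n := 2 * p) (by omega)
  have href : eggRho p !₂[h, h] ≤ 1 := by rw [eggRho_toLp]; linarith
  set T := torusCoeff j l (bidiscPullback F !₂[h, h])
  refine ⟨T / (h ^ j * h ^ l), fun z hz => ?_⟩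
  have hcases : ‖z 0‖ ^ (2 * p) ≤ 1 / 2 ∨ ‖z 1‖ ^ (2 * p) ≤ 1 / 2 := by
    by_contra! hlt
    rw [eggRho] at hz
    linarith
  unfold coordMonomial
  rw [div_mul_eq_mul_div, eq_div_iff (by positivity)]
  rcases hcases with h0 | h1
  · have hy : eggRho p !₂[z 0, h] ≤ 1 := by rw [eggRho_toLp]; linarith
    have hzy := torusCoeff_bidiscPullback_mul_pow_snd hp hF hz hy rfl j l
    have hyh := torusCoeff_bidiscPullback_mul_pow_fst hp hF hy href rfl j l
    simp only [Fin.isValue, Matrix.cons_val_zero, Matrix.cons_val_one] at hzy hyh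
    linear_combination h ^ j * hzy + z 1 ^ l * hyh
  · have hy : eggRho p !₂[h, z 1] ≤ 1 := by rw [eggRho_toLp]; linarith
    have hzy := torusCoeff_bidiscPullback_mul_pow_fst hp hF hz hy rfl j l
    have hyh := torusCoeff_bidiscPullback_mul_pow_snd hp hF hy href rfl j l
    simp only [Fin.isValue, Matrix.cons_val_zero, Matrix.cons_val_one] at hzy hyh
    linear_combination h ^ l * hzy + z 0 ^ j * hyh

theorem exists_norm_sub_dilation_le (hp : 0 < p) (hF : DiffContOnCl ℂ F (egg p)) {ε : ℝ}
    (hε : 0 < ε) : ∃ r : ℝ, 0 ≤ r ∧ r < 1 ∧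
      ∀ z ∈ closure (egg p), ‖F z - F ((r : ℂ) • z)‖ ≤ ε := by
  have hmaps : Set.MapsTo (fun q : ℝ × C2 => (q.1 : ℂ) • q.2)
      (Set.Icc 0 1 ×ˢ closure (egg p)) (closure (egg p)) := by
    rintro ⟨r, z⟩ ⟨⟨hr0, hr1⟩, hz⟩
    rcases hr1.lt_or_eq with hr1 | rfl
    · exact subset_closure (smul_mem_egg hp (by rwa [closure_egg hp] at hz) hr0 hr1)
    · simpa using hz
  have huc := (isCompact_Icc.prod (isCompact_closure_egg hp)).uniformContinuousOn_of_continuous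
    (hF.continuousOn.comp (by fun_prop) hmaps)
  obtain ⟨δ, hδ, h⟩ := Metric.uniformContinuousOn_iff_le.1 huc ε hε
  have hr0 : 0 ≤ 1 - min δ 1 := by linarith [min_le_right δ 1]
  have hr1 : 1 - min δ 1 < 1 := by linarith [lt_min hδ one_pos]
  refine ⟨1 - min δ 1, hr0, hr1, fun z hz => ?_⟩
  have hdist := h (1, z) ⟨⟨zero_le_one, le_rfl⟩, hz⟩ (1 - min δ 1, z) ⟨⟨hr0, hr1.le⟩, hz⟩
    (by simp [Prod.dist_eq, abs_of_pos, hδ, hδ.le])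
  simpa only [Function.comp_apply, Complex.ofReal_one, one_smul, dist_eq_norm] using hdist

theorem exists_mem_span_coordMonomial_norm_dilation_sub_le (hp : 0 < p)
    (hF : DiffContOnCl ℂ F (egg p)) {r : ℝ} (hr0 : 0 ≤ r) (hr1 : r < 1) {ε : ℝ} (hε : 0 < ε) :
    ∃ P ∈ Submodule.span ℂ (Set.range coordMonomial),
      ∀ z ∈ closure (egg p), ‖F ((r : ℂ) • z) - P z‖ ≤ ε := by
  obtain ⟨M, hM⟩ := (isCompact_closure_egg hp).exists_bound_of_continuousOn hF.continuousOn
  choose c hc using exists_torusCoeff_bidiscPullback_eq hp hF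
  obtain ⟨N, hN⟩ : ∃ N : ℕ, 2 * M * r ^ N / (1 - r) ^ 2 < ε := by
    have hlim : Tendsto (fun N : ℕ => 2 * M * r ^ N / (1 - r) ^ 2) atTop (𝓝 0) := by
      simpa using ((tendsto_pow_atTop_nhds_zero_of_lt_one hr0 hr1).const_mul (2 * M)).div_const
        ((1 - r) ^ 2)
    exact (hlim.eventually_lt_const hε).exists
  refine ⟨∑ j ∈ Finset.range N, ∑ l ∈ Finset.range N,
    ((r : ℂ) ^ (j + l) * c (j, l)) • coordMonomial (j, l), ?_, fun z hz => ?_⟩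
  · exact Submodule.sum_mem _ fun j _ => Submodule.sum_mem _ fun l _ =>
      Submodule.smul_mem _ _ (Submodule.subset_span ⟨_, rfl⟩)
  · rw [closure_egg hp] at hz
    have hr : ‖(r : ℂ)‖ ≤ 1 := by rw [Complex.norm_real, Real.norm_of_nonneg hr0]; exact hr1.le
    have hcauchy := norm_sub_sum_pow_mul_torusCoeff_le hr0 hr1
      (continuous_torus_bidiscPullback hp hF hz) (diffContOnCl_bidiscPullback_fst hp hF hz hr)
      (fun w hw => diffContOnCl_bidiscPullback_snd hp hF hz (mem_sphere_zero_iff_norm.1 hw).le)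
      (M := M) (fun w hw v hv => hM _ <| by
        rw [closure_egg hp]
        exact eggRho_bidisc_le hz (mem_sphere_zero_iff_norm.1 hw).le (mem_closedBall_zero_iff.1 hv))
      N
    have hcoeff (j l : ℕ) :
        torusCoeff j l (bidiscPullback F z) = c (j, l) * coordMonomial (j, l) z := hc (j, l) z hz
    refine le_trans (le_of_eq ?_) (hcauchy.trans hN.le)
    simp only [bidiscPullback_self, hcoeff, Finset.sum_apply, Pi.smul_apply, smul_eq_mul,
      mul_assoc]

theorem exists_mem_span_coordMonomial_norm_sub_le (hp : 0 < p) (hF : DiffContOnCl ℂ F (egg p))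
    {ε : ℝ} (hε : 0 < ε) : ∃ P ∈ Submodule.span ℂ (Set.range coordMonomial),
      ∀ z ∈ closure (egg p), ‖F z - P z‖ ≤ ε := by
  obtain ⟨r, hr0, hr1, hr⟩ := exists_norm_sub_dilation_le hp hF (half_pos hε)
  obtain ⟨P, hP, hrP⟩ :=
    exists_mem_span_coordMonomial_norm_dilation_sub_le hp hF hr0 hr1 (half_pos hε)
  refine ⟨P, hP, fun z hz => (norm_sub_le_norm_sub_add_norm_sub _ (F ((r : ℂ) • z)) _).trans ?_⟩
  linarith [hr z hz, hrP z hz]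

end BidiscPullback

/-! ### Beta weights -/

section Beta

variable {x y α s : ℝ}

theorem intervalIntegrable_rpow_mul_one_sub_rpow (hx : 0 < x) (hy : 0 < y) :
    IntervalIntegrable (fun s : ℝ => s ^ (x - 1) * (1 - s) ^ (y - 1)) volume 0 1 := by
  have h := (Complex.betaIntegral_convergent (u := x) (v := y) (by simpa using hx)
    (by simpa using hy)).norm
  rw [intervalIntegrable_iff_integrableOn_Ioo_of_le zero_le_one] at h ⊢
  refine h.congr_fun (fun s hs => ?_) measurableSet_Ioo
  have h1 : (1 : ℂ) - s = ((1 - s : ℝ) : ℂ) := by push_cast; rfl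
  simp only [norm_mul, h1, Complex.norm_cpow_eq_rpow_re_of_pos hs.1,
    Complex.norm_cpow_eq_rpow_re_of_pos (sub_pos.2 hs.2), Complex.sub_re, Complex.ofReal_re,
    Complex.one_re]

theorem eulerBeta_pos (hx : 0 < x) (hy : 0 < y) : 0 < eulerBeta x y :=
  intervalIntegral.intervalIntegral_pos_of_pos_on
    (intervalIntegrable_rpow_mul_one_sub_rpow hx hy)
    (fun _ hs => mul_pos (Real.rpow_pos_of_pos hs.1 _) (Real.rpow_pos_of_pos (sub_pos.2 hs.2) _))
    zero_lt_one

/-- The measure `(s (1 - s))^{α - 1} ds` on `(0, 1)`. Up to constants it is the image of `σ` (for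
`α = 1/p`) and of `ωₚ` (for `α = 1`) under the coordinate `s`. -/
def radialMeasure (α : ℝ) : Measure ℝ :=
  (volume.restrict (Set.Ioo 0 1)).withDensity fun s =>
    ENNReal.ofReal (s ^ (α - 1) * (1 - s) ^ (α - 1))

theorem ofReal_radial_ne_zero (hs : s ∈ Set.Ioo (0 : ℝ) 1) :
    ENNReal.ofReal (s ^ (α - 1) * (1 - s) ^ (α - 1)) ≠ 0 := by
  have h0 := hs.1
  have h1 := sub_pos.2 hs.2
  simpa using by positivity

theorem isFiniteMeasure_radialMeasure (hα : 0 < α) : IsFiniteMeasure (radialMeasure α) :=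
  isFiniteMeasure_withDensity_ofReal ((intervalIntegrable_iff_integrableOn_Ioo_of_le zero_le_one).1
    (intervalIntegrable_rpow_mul_one_sub_rpow hα hα)).2

theorem radialMeasure_absolutelyContinuous (α : ℝ) :
    radialMeasure α ≪ volume.restrict (Set.Ioo 0 1) :=
  withDensity_absolutelyContinuous _ _

theorem radialMeasure_ne_zero_of_mem_nhds (α : ℝ) (hs : s ∈ Set.Icc (0 : ℝ) 1) {U : Set ℝ}
    (hU : U ∈ 𝓝 s) : radialMeasure α U ≠ 0 := by
  have hac : volume.restrict (Set.Ioo 0 1) ≪ radialMeasure α :=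
    withDensity_absolutelyContinuous' (by fun_prop)
      ((ae_restrict_mem measurableSet_Ioo).mono fun _ => ofReal_radial_ne_zero)
  have hpos : 0 < volume (interior U ∩ Set.Ioo 0 1) := by
    refine (isOpen_interior.inter isOpen_Ioo).measure_pos _ ?_
    rw [← closure_Ioo zero_ne_one] at hs
    exact mem_closure_iff_nhds.1 hs _ (interior_mem_nhds.2 hU)
  refine fun h => hpos.ne' ?_
  rw [← Measure.restrict_apply isOpen_interior.measurableSet]
  exact hac (measure_mono_null interior_subset h)

theorem integral_rpow_mul_one_sub_rpow_radialMeasure (x y α : ℝ) :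
    ∫ s, s ^ x * (1 - s) ^ y ∂radialMeasure α = eulerBeta (x + α) (y + α) := by
  rw [radialMeasure, integral_withDensity_eq_integral_toReal_smul (by fun_prop)
    (Eventually.of_forall fun _ => ENNReal.ofReal_lt_top), eulerBeta,
    intervalIntegral.integral_of_le zero_le_one, integral_Ioc_eq_integral_Ioo]
  refine setIntegral_congr_fun measurableSet_Ioo fun s ⟨h0, h1⟩ => ?_
  replace h1 := sub_pos.2 h1
  rw [ENNReal.toReal_ofReal (by positivity), smul_eq_mul, mul_mul_mul_comm, ← Real.rpow_add h0,
    ← Real.rpow_add h1]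
  congr 2 <;> ring

theorem ae_radialMeasure_nonneg (x y α : ℝ) :
    0 ≤ᵐ[radialMeasure α] fun s => s ^ x * (1 - s) ^ y := by
  refine radialMeasure_absolutelyContinuous α ?_
  filter_upwards [ae_restrict_mem measurableSet_Ioo] with s hs
  exact mul_nonneg (Real.rpow_nonneg hs.1.le _) (Real.rpow_nonneg (sub_nonneg.2 hs.2.le) _)

theorem integrable_rpow_mul_one_sub_rpow_radialMeasure (hα : 0 < α) (hx : 0 ≤ x) (hy : 0 ≤ y) :
    Integrable (fun s => s ^ x * (1 - s) ^ y) (radialMeasure α) := by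
  have := isFiniteMeasure_radialMeasure hα
  refine Integrable.of_bound (by fun_prop) 1 (radialMeasure_absolutelyContinuous α ?_)
  filter_upwards [ae_restrict_mem measurableSet_Ioo] with s ⟨h0, h1⟩
  have h1' := sub_pos.2 h1
  rw [Real.norm_of_nonneg (by positivity)]
  exact mul_le_one₀ (Real.rpow_le_one h0.le h1.le hx) (by positivity)
    (Real.rpow_le_one h1'.le (by linarith) hy)

end Beta

/-! ### Hardy spaces of rotation-invariant measures -/

section Reinhardt

theorem exists_circle_mul_eq {w z : ℂ} (h : ‖w‖ = ‖z‖) : ∃ u : Circle, u * w = z := by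
  rcases eq_or_ne w 0 with rfl | hw
  · exact ⟨1, by simpa [eq_comm] using h⟩
  · refine ⟨⟨z / w, ?_⟩, div_mul_cancel₀ _ hw⟩
    simp [Submonoid.unitSphere, ← h, hw]

theorem exists_torusRotation_eq {p : ℕ} (hp : 0 < p) {w z : C2} (hw : eggRho p w = 1)
    (hz : eggRho p z = 1) (h : radialCoord p w = radialCoord p z) :
    ∃ u, torusRotation u w = z := by
  have hpow : 2 * p ≠ 0 := by omega
  have h0 : ‖w 0‖ = ‖z 0‖ := (pow_left_inj₀ (norm_nonneg _) (norm_nonneg _) hpow).1 h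
  have h1 : ‖w 1‖ = ‖z 1‖ := (pow_left_inj₀ (norm_nonneg _) (norm_nonneg _) hpow).1 <| by
    rw [← one_sub_radialCoord hw, ← one_sub_radialCoord hz, h]
  obtain ⟨u, hu⟩ := exists_circle_mul_eq h0
  obtain ⟨v, hv⟩ := exists_circle_mul_eq h1
  refine ⟨![u, v], ?_⟩
  ext i
  fin_cases i
  exacts [hu, hv]

theorem coordMonomial_torusRotation (u : Fin 2 → Circle) (x : ℕ × ℕ) (z : C2) :
    coordMonomial x (torusRotation u z) =
      (u 0 : ℂ) ^ x.1 * (u 1 : ℂ) ^ x.2 * coordMonomial x z := by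
  simp only [coordMonomial, torusRotation_apply, mul_pow]
  ring

theorem exists_circle_pow_mul_conj_pow_eq_neg_one {m n : ℕ} (h : m ≠ n) :
    ∃ u : Circle, (u : ℂ) ^ m * (starRingEnd ℂ) ((u : ℂ) ^ n) = -1 := by
  refine ⟨Circle.exp (Real.pi / ((m : ℝ) - n)), ?_⟩
  have hne : (m : ℂ) - n ≠ 0 := sub_ne_zero.2 (by exact_mod_cast h)
  rw [Circle.coe_exp, map_pow, ← Complex.exp_conj, ← Complex.exp_nat_mul, ← Complex.exp_nat_mul,
    ← Complex.exp_add, ← Complex.exp_pi_mul_I]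
  congr 1
  rw [map_mul, Complex.conj_ofReal, Complex.conj_I]
  push_cast
  field_simp
  ring

theorem norm_sq_coordMonomial {p : ℕ} (hp : 0 < p) {z : C2} (hz : eggRho p z = 1) (x : ℕ × ℕ) :
    ‖coordMonomial x z‖ ^ 2 =
      radialCoord p z ^ ((x.1 : ℝ) / p) * (1 - radialCoord p z) ^ ((x.2 : ℝ) / p) := by
  have hpow (i : Fin 2) (j : ℕ) : (‖z i‖ ^ (2 * p)) ^ ((j : ℝ) / p) = (‖z i‖ ^ j) ^ 2 := by
    have hp' : (p : ℝ) ≠ 0 := by exact_mod_cast hp.ne'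
    rw [← Real.rpow_natCast_mul (norm_nonneg _), ← pow_mul, ← Real.rpow_natCast]
    congr 1
    push_cast
    field_simp
  rw [one_sub_radialCoord hz, radialCoord, hpow, hpow, coordMonomial, norm_mul, norm_pow, norm_pow,
    mul_pow]

end Reinhardt

/-- A rotation-invariant measure on `b𝓔ₚ` whose image under the coordinate `s` is comparable to
`(s (1 - s))^{α - 1} ds`. -/
structure IsEggMeasure (p : ℕ) (α : ℝ) (ν : Measure C2) : Prop where
  order_pos : 0 < p
  exponent_pos : 0 < α
  eggRho_eq_one : ∀ᵐ z ∂ν, eggRho p z = 1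
  measurePreserving_torusRotation (u : Fin 2 → Circle) : MeasurePreserving (torusRotation u) ν ν
  comparable_map : Comparable (ν.map (radialCoord p)) (radialMeasure α)

namespace IsEggMeasure

variable {p : ℕ} {α : ℝ} {ν : Measure C2}

theorem isFiniteMeasure (hν : IsEggMeasure p α ν) : IsFiniteMeasure ν := by
  have := isFiniteMeasure_radialMeasure hν.exponent_pos
  have := hν.comparable_map.1.isFiniteMeasure
  exact Measure.isFiniteMeasure_of_map (continuous_radialCoord p).aemeasurable

/-- The torus orbit of a neighbourhood of `z` contains all boundary points whose coordinate `s` is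
close to that of `z`, by compactness of the boundary. -/
theorem measure_ne_zero_of_mem_nhds (hν : IsEggMeasure p α ν) {z : C2} (hz : eggRho p z = 1)
    {U : Set C2} (hU : U ∈ 𝓝 z) : ν U ≠ 0 := by
  intro hU0
  set V : Set C2 := ⋃ u, torusRotation u ⁻¹' interior U with hV
  have hVopen (u : Fin 2 → Circle) : IsOpen (torusRotation u ⁻¹' interior U) :=
    isOpen_interior.preimage (torusRotation u).continuous
  have hV0 : ν V = 0 := by
    obtain ⟨T, hT, hTV⟩ := TopologicalSpace.isOpen_iUnion_countable _ hVopen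
    rw [hV, ← hTV, measure_biUnion_null_iff hT]
    intro u _
    rw [(hν.measurePreserving_torusRotation u).measure_preimage isOpen_interior.nullMeasurableSet]
    exact measure_mono_null interior_subset hU0
  set K : Set ℝ := radialCoord p '' ({w | eggRho p w = 1} \ V) with hK
  have hKclosed : IsClosed K := by
    rw [hK, ← frontier_egg hν.order_pos]
    exact (((isCompact_frontier_egg hν.order_pos).diff (isOpen_iUnion hVopen)).image
      (continuous_radialCoord p)).isClosed
  have hzK : radialCoord p z ∉ K := by
    rintro ⟨w, ⟨hw, hwV⟩, hwz⟩
    obtain ⟨u, hu⟩ := exists_torusRotation_eq hν.order_pos hw hz hwz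
    exact hwV (Set.mem_iUnion.2 ⟨u, by simpa [hu] using mem_interior_iff_mem_nhds.2 hU⟩)
  refine radialMeasure_ne_zero_of_mem_nhds α ⟨by unfold radialCoord; positivity,
    radialCoord_le_one hz.le⟩ (hKclosed.isOpen_compl.mem_nhds hzK)
    (hν.comparable_map.2.absolutelyContinuous ?_)
  rw [Measure.map_apply (continuous_radialCoord p).measurable hKclosed.measurableSet.compl]
  refine measure_mono_null_ae ?_ hV0
  filter_upwards [hν.eggRho_eq_one] with w hw hwK
  by_contra hwV
  exact hwK ⟨w, ⟨hw, hwV⟩, rfl⟩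

theorem support_eq (hν : IsEggMeasure p α ν) : ν.support = frontier (egg p) := by
  refine Set.Subset.antisymm (Measure.support_subset_of_isClosed isClosed_frontier ?_)
    fun z hz => ?_
  · rw [frontier_egg hν.order_pos]
    exact hν.eggRho_eq_one
  · rw [frontier_egg hν.order_pos] at hz
    exact (Measure.mem_support_iff_forall z).2 fun U hU =>
      pos_iff_ne_zero.2 (hν.measure_ne_zero_of_mem_nhds hz hU)

theorem integral_inner_coordMonomial_eq_zero (hν : IsEggMeasure p α ν) {x y : ℕ × ℕ}
    (hxy : x ≠ y) : ∫ z, inner ℂ (coordMonomial x z) (coordMonomial y z) ∂ν = 0 := by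
  obtain ⟨u, hu⟩ : ∃ u : Fin 2 → Circle, (u 0 : ℂ) ^ y.1 * (u 1 : ℂ) ^ y.2 *
      (starRingEnd ℂ) ((u 0 : ℂ) ^ x.1 * (u 1 : ℂ) ^ x.2) = -1 := by
    by_cases h1 : y.1 = x.1
    · have h2 : y.2 ≠ x.2 := fun h => hxy (Prod.ext h1.symm h.symm)
      obtain ⟨v, hv⟩ := exists_circle_pow_mul_conj_pow_eq_neg_one h2
      exact ⟨![1, v], by simpa using hv⟩
    · obtain ⟨v, hv⟩ := exists_circle_pow_mul_conj_pow_eq_neg_one h1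
      exact ⟨![v, 1], by simpa using hv⟩
  have hrot (z : C2) : inner ℂ (coordMonomial x (torusRotation u z))
      (coordMonomial y (torusRotation u z)) =
      -inner ℂ (coordMonomial x z) (coordMonomial y z) := by
    rw [coordMonomial_torusRotation, coordMonomial_torusRotation, RCLike.inner_apply,
      RCLike.inner_apply, map_mul]
    linear_combination coordMonomial y z * (starRingEnd ℂ) (coordMonomial x z) * hu
  have hint := (hν.measurePreserving_torusRotation u).integral_comp
    (torusRotation u).toHomeomorph.measurableEmbedding
    fun z => inner ℂ (coordMonomial x z) (coordMonomial y z)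
  simp only [hrot, integral_neg] at hint
  exact self_eq_neg.1 hint.symm

theorem memLp_coordMonomial (hν : IsEggMeasure p α ν) (x : ℕ × ℕ) :
    MemLp (coordMonomial x) 2 ν := by
  have := hν.isFiniteMeasure
  refine MemLp.of_bound (continuous_coordMonomial x).aestronglyMeasurable 1 ?_
  filter_upwards [hν.eggRho_eq_one] with z hz
  rw [coordMonomial, norm_mul, norm_pow, norm_pow]
  exact mul_le_one₀ (pow_le_one₀ (norm_nonneg _) (norm_coord_le_one hν.order_pos hz.le 0))
    (by positivity) (pow_le_one₀ (norm_nonneg _) (norm_coord_le_one hν.order_pos hz.le 1))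

/-- The class of the monomial `z^x` in `L²(ν)`. -/
def monomialLp (hν : IsEggMeasure p α ν) (x : ℕ × ℕ) : Lp ℂ 2 ν :=
  (hν.memLp_coordMonomial x).toLp

theorem coeFn_monomialLp (hν : IsEggMeasure p α ν) (x : ℕ × ℕ) :
    hν.monomialLp x =ᵐ[ν] coordMonomial x := MemLp.coeFn_toLp _

theorem inner_monomialLp (hν : IsEggMeasure p α ν) (x y : ℕ × ℕ) :
    inner ℂ (hν.monomialLp x) (hν.monomialLp y) =
      ∫ z, inner ℂ (coordMonomial x z) (coordMonomial y z) ∂ν := by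
  rw [L2.inner_def]
  refine integral_congr_ae ?_
  filter_upwards [hν.coeFn_monomialLp x, hν.coeFn_monomialLp y] with z h1 h2
  rw [h1, h2]

theorem pairwise_inner_monomialLp (hν : IsEggMeasure p α ν) :
    Pairwise fun x y => inner ℂ (hν.monomialLp x) (hν.monomialLp y) = 0 :=
  fun x y h => (hν.inner_monomialLp x y).trans (hν.integral_inner_coordMonomial_eq_zero h)

theorem norm_sq_monomialLp (hν : IsEggMeasure p α ν) (x : ℕ × ℕ) :
    ‖hν.monomialLp x‖ ^ 2 =
      ∫ s, s ^ ((x.1 : ℝ) / p) * (1 - s) ^ ((x.2 : ℝ) / p) ∂ν.map (radialCoord p) := by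
  rw [integral_map (continuous_radialCoord p).aemeasurable (by fun_prop),
    @norm_sq_eq_re_inner ℂ, hν.inner_monomialLp]
  have hcongr : ∫ z, inner ℂ (coordMonomial x z) (coordMonomial x z) ∂ν =
      ∫ z, ((radialCoord p z ^ ((x.1 : ℝ) / p) *
        (1 - radialCoord p z) ^ ((x.2 : ℝ) / p) : ℝ) : ℂ) ∂ν := by
    refine integral_congr_ae ?_
    filter_upwards [hν.eggRho_eq_one] with z hz
    rw [← norm_sq_coordMonomial hν.order_pos hz, inner_self_eq_norm_sq_to_K]
    push_cast
    rfl
  rw [hcongr, integral_complex_ofReal]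
  rfl

theorem exists_norm_sq_monomialLp_le (hν : IsEggMeasure p α ν) : ∃ C : ℝ, ∀ x,
    ‖hν.monomialLp x‖ ^ 2 ≤ C * eulerBeta ((x.1 : ℝ) / p + α) ((x.2 : ℝ) / p + α) := by
  obtain ⟨C, hC⟩ := hν.comparable_map.1.exists_integral_le
  refine ⟨C, fun x => ?_⟩
  rw [norm_sq_monomialLp, ← integral_rpow_mul_one_sub_rpow_radialMeasure]
  exact hC _ (ae_radialMeasure_nonneg _ _ _) (integrable_rpow_mul_one_sub_rpow_radialMeasure
    hν.exponent_pos (by positivity) (by positivity))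

theorem exists_eulerBeta_le_norm_sq_monomialLp (hν : IsEggMeasure p α ν) : ∃ C : ℝ, ∀ x : ℕ × ℕ,
    eulerBeta ((x.1 : ℝ) / p + α) ((x.2 : ℝ) / p + α) ≤ C * ‖hν.monomialLp x‖ ^ 2 := by
  have := isFiniteMeasure_radialMeasure hν.exponent_pos
  obtain ⟨D, hD⟩ := hν.comparable_map.1
  obtain ⟨C, hC⟩ := hν.comparable_map.2.exists_integral_le
  refine ⟨C, fun x => ?_⟩
  rw [norm_sq_monomialLp, ← integral_rpow_mul_one_sub_rpow_radialMeasure]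
  refine hC _ (hν.comparable_map.1.absolutelyContinuous (ae_radialMeasure_nonneg _ _ _)) ?_
  exact ((integrable_rpow_mul_one_sub_rpow_radialMeasure hν.exponent_pos (by positivity)
    (by positivity)).smul_measure_nnreal (c := D)).mono_measure hD

theorem eulerBeta_weight_pos (hν : IsEggMeasure p α ν) (x : ℕ × ℕ) :
    0 < eulerBeta ((x.1 : ℝ) / p + α) ((x.2 : ℝ) / p + α) := by
  have := hν.exponent_pos
  exact eulerBeta_pos (by positivity) (by positivity)

theorem monomialLp_ne_zero (hν : IsEggMeasure p α ν) (x : ℕ × ℕ) : hν.monomialLp x ≠ 0 := by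
  obtain ⟨C, hC⟩ := hν.exists_eulerBeta_le_norm_sq_monomialLp
  intro h
  have hle := hC x
  rw [h, norm_zero, zero_pow two_ne_zero, mul_zero] at hle
  exact (hν.eulerBeta_weight_pos x).not_ge hle

theorem coeFn_sum_monomialLp (hν : IsEggMeasure p α ν) (S : Finset (ℕ × ℕ)) (a : ℕ × ℕ → ℂ) :
    ⇑(∑ x ∈ S, a x • hν.monomialLp x) =ᵐ[ν] fun z => ∑ x ∈ S, a x * coordMonomial x z := by
  have hterm (x : ℕ × ℕ) :
      ⇑(a x • hν.monomialLp x) =ᵐ[ν] fun z => a x * coordMonomial x z := by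
    filter_upwards [Lp.coeFn_smul (a x) (hν.monomialLp x), hν.coeFn_monomialLp x] with z h1 h2
    rw [h1, Pi.smul_apply, h2, smul_eq_mul]
  filter_upwards [Lp.coeFn_fun_finsetSum S fun x => a x • hν.monomialLp x,
    ae_all_iff.2 hterm] with z h1 h2
  rw [h1]
  exact Finset.sum_congr rfl fun x _ => h2 x

theorem isEggSeries_iff_hasSum (hν : IsEggMeasure p α ν) (a : ℕ × ℕ → ℂ) (f : Lp ℂ 2 ν) :
    IsEggSeries p ν a f ↔ HasSum (fun x => a x • hν.monomialLp x) f := by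
  rw [HasSum, SummationFilter.unconditional_filter, Lp.tendsto_Lp_iff_tendsto_eLpNorm', IsEggSeries]
  refine iff_of_eq (congrArg (Tendsto · atTop (𝓝 0)) (funext fun S => ?_))
  rw [← eLpNorm_neg]
  refine eLpNorm_congr_ae ?_
  filter_upwards [hν.coeFn_sum_monomialLp S a, hν.eggRho_eq_one] with z hz hz'
  rw [Pi.neg_apply, Pi.sub_apply, hz, neg_sub]
  simp only [eggTerm_eggCoords hν.order_pos hz']

theorem diffContOnCl_of_mem_algA (hν : IsEggMeasure p α ν) {F : C2 → ℂ} (hF : F ∈ algA (egg p) ν) :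
    DiffContOnCl ℂ F (egg p) := by
  refine ⟨hF.1, hF.2.mono ?_⟩
  rw [hν.support_eq, closure_eq_self_union_frontier]

theorem mem_closure_span_monomialLp (hν : IsEggMeasure p α ν) {F : C2 → ℂ}
    (hF : F ∈ algA (egg p) ν) {f : Lp ℂ 2 ν} (hf : f =ᵐ[ν] F) :
    f ∈ closure (Submodule.span ℂ (Set.range hν.monomialLp) : Set (Lp ℂ 2 ν)) := by
  have := hν.isFiniteMeasure
  rw [Metric.mem_closure_iff]
  intro ε hε
  set m : ℝ := measureUnivNNReal ν ^ (2 : ℝ≥0∞).toReal⁻¹ with hm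
  have : 0 ≤ m := by positivity
  obtain ⟨P, hP, hFP⟩ := exists_mem_span_coordMonomial_norm_sub_le hν.order_pos
    (hν.diffContOnCl_of_mem_algA hF) (ε := ε / (m + 1)) (by positivity)
  obtain ⟨c, rfl⟩ := Finsupp.mem_span_range_iff_exists_finsupp.1 hP
  refine ⟨c.sum fun x a => a • hν.monomialLp x,
    Finsupp.mem_span_range_iff_exists_finsupp.2 ⟨c, rfl⟩, ?_⟩
  rw [dist_eq_norm]
  refine (Lp.norm_le_of_ae_bound (C := ε / (m + 1)) (by positivity) ?_).trans_lt ?_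
  · filter_upwards [hν.coeFn_sum_monomialLp c.support c,
      Lp.coeFn_sub f (c.sum fun x a => a • hν.monomialLp x), hf, hν.eggRho_eq_one]
      with z h1 h2 h3 h4
    have hz : z ∈ closure (egg p) := by rw [closure_egg hν.order_pos]; exact h4.le
    rw [h2, Pi.sub_apply, Finsupp.sum, h1, h3]
    simpa [Finsupp.sum] using hFP z hz
  · rw [← hm, mul_div_assoc', div_lt_iff₀ (by positivity)]
    linarith

theorem exists_mem_algA_of_mem_span (hν : IsEggMeasure p α ν) {f : Lp ℂ 2 ν}
    (hf : f ∈ Submodule.span ℂ (Set.range hν.monomialLp)) : ∃ F ∈ algA (egg p) ν, f =ᵐ[ν] F := by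
  obtain ⟨c, rfl⟩ := Finsupp.mem_span_range_iff_exists_finsupp.1 hf
  have := differentiable_coordMonomial
  have hd : Differentiable ℂ fun z => ∑ x ∈ c.support, c x * coordMonomial x z := by fun_prop
  exact ⟨_, ⟨hd.differentiableOn, hd.continuous.continuousOn⟩, hν.coeFn_sum_monomialLp c.support c⟩

theorem hardySpace_eq_setOf_hasSum (hν : IsEggMeasure p α ν) :
    hardySpace (egg p) ν = {f | ∃ a : ℕ × ℕ → ℂ, HasSum (fun x => a x • hν.monomialLp x) f} := by
  rw [← closure_span_eq_of_orthogonal hν.pairwise_inner_monomialLp hν.monomialLp_ne_zero]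
  exact Set.Subset.antisymm
    (closure_minimal (fun f ⟨_, hF, hf⟩ => hν.mem_closure_span_monomialLp hF hf) isClosed_closure)
    (closure_mono fun _ hf => hν.exists_mem_algA_of_mem_span hf)

theorem summable_smul_monomialLp_iff (hν : IsEggMeasure p α ν) (a : ℕ × ℕ → ℂ) :
    (Summable fun x => a x • hν.monomialLp x) ↔ Summable fun x : ℕ × ℕ =>
      ‖a x‖ ^ 2 * eulerBeta ((x.1 : ℝ) / p + α) ((x.2 : ℝ) / p + α) := by
  rw [summable_smul_iff_of_orthogonal hν.pairwise_inner_monomialLp hν.monomialLp_ne_zero]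
  obtain ⟨C, hC⟩ := hν.exists_norm_sq_monomialLp_le
  obtain ⟨D, hD⟩ := hν.exists_eulerBeta_le_norm_sq_monomialLp
  refine ⟨fun h => (h.mul_left D).of_nonneg_of_le
    (fun x => mul_nonneg (by positivity) (hν.eulerBeta_weight_pos x).le) fun x => ?_,
    fun h => (h.mul_left C).of_nonneg_of_le (fun x => by positivity) fun x => ?_⟩
  · rw [mul_left_comm]
    exact mul_le_mul_of_nonneg_left (hD x) (by positivity)
  · rw [mul_left_comm]
    exact mul_le_mul_of_nonneg_left (hC x) (by positivity)

theorem exists_isEggSeries (hν : IsEggMeasure p α ν) {a : ℕ × ℕ → ℂ}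
    (ha : Summable fun x : ℕ × ℕ =>
      ‖a x‖ ^ 2 * eulerBeta ((x.1 : ℝ) / p + α) ((x.2 : ℝ) / p + α)) :
    ∃ f : Lp ℂ 2 ν, IsEggSeries p ν a f := by
  obtain ⟨f, hf⟩ := (hν.summable_smul_monomialLp_iff a).2 ha
  exact ⟨f, (hν.isEggSeries_iff_hasSum a f).2 hf⟩

theorem hardySpace_eq (hν : IsEggMeasure p α ν) :
    hardySpace (egg p) ν = {f : Lp ℂ 2 ν | ∃ a : ℕ × ℕ → ℂ, (Summable fun x : ℕ × ℕ =>
      ‖a x‖ ^ 2 * eulerBeta ((x.1 : ℝ) / p + α) ((x.2 : ℝ) / p + α)) ∧ IsEggSeries p ν a f} := by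
  rw [hν.hardySpace_eq_setOf_hasSum]
  refine Set.ext fun f => exists_congr fun a => ?_
  rw [hν.isEggSeries_iff_hasSum, ← hν.summable_smul_monomialLp_iff]
  exact ⟨fun h => ⟨h.summable, h⟩, fun h => h.2⟩

end IsEggMeasure

/-! ### Bi-Lipschitz images and Hausdorff measure -/

section BiLipschitz

variable {X Y : Type*} [EMetricSpace X] [MeasurableSpace X] [BorelSpace X] [EMetricSpace Y]
  [MeasurableSpace Y] [BorelSpace Y] {K K' : NNReal} {f : X → Y} {s : Set X}

theorem euclideanHausdorffMeasure_image_le (h : LipschitzOnWith K f s) (d : ℕ) :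
    (μHE[d] : Measure Y) (f '' s) ≤ (K : ℝ≥0∞) ^ d * (μHE[d] : Measure X) s := by
  simp only [Measure.euclideanHausdorffMeasure_def, Measure.smul_apply, ENNReal.smul_def,
    smul_eq_mul]
  rw [mul_left_comm]
  gcongr
  simpa using h.hausdorffMeasure_image_le (d := d) (by positivity)

theorem le_euclideanHausdorffMeasure_image (h : AntilipschitzWith K (s.domRestrict f)) (d : ℕ) :
    (μHE[d] : Measure X) s ≤ (K : ℝ≥0∞) ^ d * (μHE[d] : Measure Y) (f '' s) := by
  simp only [Measure.euclideanHausdorffMeasure_def, Measure.smul_apply, ENNReal.smul_def,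
    smul_eq_mul]
  rw [mul_left_comm]
  gcongr
  have hcoe : Isometry ((↑) : s → X) := isometry_subtype_coe
  have himg := hcoe.hausdorffMeasure_image (d := (d : ℝ)) (Or.inl (by positivity)) Set.univ
  rw [Set.image_univ, Subtype.range_coe] at himg
  have hle := h.le_hausdorffMeasure_image (d := (d : ℝ)) (by positivity) Set.univ
  rwa [← himg, Set.image_univ, Set.range_domRestrict, ENNReal.rpow_natCast] at hle

theorem comparable_map_restrict_euclideanHausdorffMeasure (hf : Measurable f)
    (hL : LipschitzOnWith K f s) (hA : AntilipschitzWith K' (s.domRestrict f)) (d : ℕ) :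
    Comparable (((μHE[d] : Measure X).restrict s).map f)
      ((μHE[d] : Measure Y).restrict (f '' s)) := by
  have himg : ∀ B, f '' (f ⁻¹' B ∩ s) = B ∩ f '' s := fun B => by
    rw [Set.inter_comm, Set.image_inter_preimage, Set.inter_comm]
  refine ⟨⟨K' ^ d, Measure.le_iff.2 fun B hB => ?_⟩, ⟨K ^ d, Measure.le_iff.2 fun B hB => ?_⟩⟩
  all_goals
    rw [Measure.smul_apply, ENNReal.smul_def, smul_eq_mul, Measure.map_apply hf hB,
      Measure.restrict_apply (hf hB), Measure.restrict_apply hB, ← himg, ENNReal.coe_pow]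
  · have hsub : f ⁻¹' B ∩ s ⊆ s := Set.inter_subset_right
    exact le_euclideanHausdorffMeasure_image
      (fun x y => hA (Set.inclusion hsub x) (Set.inclusion hsub y)) d
  · exact euclideanHausdorffMeasure_image_le (hL.mono Set.inter_subset_right) d

end BiLipschitz

theorem exists_euclideanHausdorffMeasure_eq_smul_volume :
    ∃ k : NNReal, k ≠ 0 ∧ (μHE[3] : Measure (ℂ × ℝ)) = k • volume := by
  have hrank : Module.finrank ℝ (ℂ × ℝ) = 3 := by simp
  have : (μHE[3] : Measure (ℂ × ℝ)).IsAddHaarMeasure := by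
    rw [← hrank]; infer_instance
  have : (volume : Measure (ℂ × ℝ)).IsAddHaarMeasure :=
    inferInstanceAs ((volume : Measure ℂ).prod (volume : Measure ℝ)).IsAddHaarMeasure
  have h := Measure.isAddLeftInvariant_eq_smul (μHE[3] : Measure (ℂ × ℝ)) volume
  refine ⟨_, fun h0 => ?_, h⟩
  rw [h0, zero_smul] at h
  exact NeZero.ne (μHE[3] : Measure (ℂ × ℝ)) h

/-! ### The boundary of the egg as a graph -/

/-- The parametrization `(w, θ) ↦ (w, (1 - |w|^{2p})^{1/2p} e^{iθ})` of `b𝓔ₚ`. It is smooth only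
where `|w| < 1`, so it is used for `|w|^{2p} ≤ 2/3`; the rest of `b𝓔ₚ` is reached by `coordSwap`. -/
def graphParam (p : ℕ) (q : ℂ × ℝ) : C2 :=
  !₂[q.1, (((1 - ‖q.1‖ ^ (2 * p)) ^ (1 / (2 * p : ℝ)) : ℝ) : ℂ) * Circle.exp q.2]

/-- The domain `|w|^{2p} ≤ 2/3`, `0 ≤ θ ≤ 1`, on which `graphParam p` is bi-Lipschitz. -/
def sectorDomain (p : ℕ) : Set (ℂ × ℝ) := {w : ℂ | ‖w‖ ^ (2 * p) ≤ 2 / 3} ×ˢ Set.Icc 0 1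

/-- The sector of `b𝓔ₚ` parametrized by `sectorDomain p`. -/
def eggSector (p : ℕ) : Set C2 := graphParam p '' sectorDomain p

section Graph

variable {p : ℕ}

theorem continuous_graphParam (p : ℕ) : Continuous (graphParam p) := by
  have hradius : Continuous fun q : ℂ × ℝ => (1 - ‖q.1‖ ^ (2 * p)) ^ (1 / (2 * p : ℝ)) :=
    (Real.continuous_rpow_const (by positivity)).comp (by fun_prop)
  have : Continuous fun q : ℂ × ℝ => (Circle.exp q.2 : ℂ) := by fun_prop
  unfold graphParam
  fun_prop

theorem isCompact_sectorDomain (hp : 0 < p) : IsCompact (sectorDomain p) := by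
  refine IsCompact.prod (Metric.isCompact_of_isClosed_isBounded
    (isClosed_le (by fun_prop) continuous_const) ?_) isCompact_Icc
  refine (Metric.isBounded_closedBall (x := (0 : ℂ)) (r := 1)).subset fun w hw => ?_
  rw [mem_closedBall_zero_iff]
  have : ‖w‖ ^ (2 * p) ≤ 1 := le_trans hw (by norm_num)
  exact (pow_le_one_iff_of_nonneg (norm_nonneg _) (by omega)).1 this

theorem measurableSet_eggSector (hp : 0 < p) : MeasurableSet (eggSector p) :=
  ((isCompact_sectorDomain hp).image (continuous_graphParam p)).isClosed.measurableSet

theorem contDiffAt_graphParam {q : ℂ × ℝ} (hq : ‖q.1‖ ^ (2 * p) < 1) :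
    ContDiffAt ℝ 1 (graphParam p) q := by
  have hradius :
      ContDiffAt ℝ 1 (fun q : ℂ × ℝ => (1 - ‖q.1‖ ^ (2 * p)) ^ (1 / (2 * p : ℝ))) q := by
    refine ContDiffAt.rpow_const_of_ne (contDiffAt_const.sub ?_) (by linarith)
    simp only [pow_mul]
    exact ((contDiff_norm_sq ℝ).contDiffAt.comp q contDiffAt_fst).pow p
  have hexp : ContDiff ℝ 1 fun θ : ℝ => (Circle.exp θ : ℂ) := by
    simp only [Circle.coe_exp]
    exact (Complex.ofRealCLM.contDiff.mul contDiff_const).cexp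
  rw [contDiffAt_piLp]
  intro i
  fin_cases i
  · exact contDiffAt_fst
  · exact (Complex.ofRealCLM.contDiff.contDiffAt.comp q hradius).mul
      (hexp.contDiffAt.comp q contDiffAt_snd)

theorem exists_lipschitzOnWith_graphParam (hp : 0 < p) :
    ∃ K, LipschitzOnWith K (graphParam p) (sectorDomain p) := by
  refine LocallyLipschitzOn.exists_lipschitzOnWith_of_compact (isCompact_sectorDomain hp) ?_
  intro q hq
  obtain ⟨K, t, ht, hK⟩ := (contDiffAt_graphParam (p := p) (q := q)
    (lt_of_le_of_lt hq.1 (by norm_num))).exists_lipschitzOnWith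
  exact ⟨K, t, mem_nhdsWithin_of_mem_nhds ht, hK⟩

theorem third_le_rpow_one_sub (hp : 0 < p) {t : ℝ} (h0 : 0 ≤ t) (ht : t ≤ 2 / 3) :
    1 / 3 ≤ (1 - t) ^ (1 / (2 * p : ℝ)) := by
  have hp' : (1 : ℝ) ≤ p := by exact_mod_cast hp
  have he : 1 / (2 * p : ℝ) ≤ 1 := by
    rw [div_le_one (by positivity)]; linarith
  calc (1 / 3 : ℝ) ≤ 1 - t := by linarith
    _ ≤ (1 - t) ^ (1 / (2 * p : ℝ)) := Real.self_le_rpow_of_le_one (by linarith) (by linarith) he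

theorem abs_sub_le_norm_polar_sub {ρ ρ' θ θ' : ℝ} (hρ : 1 / 3 ≤ ρ) (h : |θ - θ'| ≤ 1) :
    |θ - θ'| ≤ 6 * ‖(ρ : ℂ) * Circle.exp θ - ρ' * Circle.exp θ'‖ := by
  have hrot : (ρ : ℂ) * Circle.exp θ - ρ' * Circle.exp θ' =
      Circle.exp θ' * ((ρ : ℂ) * Circle.exp (θ - θ') - ρ') := by
    have : (Circle.exp θ : ℂ) = Circle.exp θ' * Circle.exp (θ - θ') := by
      rw [← Circle.coe_mul, ← Circle.exp_add, add_sub_cancel]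
    rw [this]
    ring
  have him : ((ρ : ℂ) * Circle.exp (θ - θ') - ρ').im = ρ * Real.sin (θ - θ') := by
    rw [Circle.coe_exp, Complex.exp_mul_I, ← Complex.ofReal_cos, ← Complex.ofReal_sin,
      Complex.sub_im, Complex.im_ofReal_mul]
    simp [-Complex.ofReal_sub, -Complex.ofReal_cos, -Complex.ofReal_sin]
  have hsin : 1 / 2 * |θ - θ'| ≤ |Real.sin (θ - θ')| := by
    have hpi : 1 / 2 ≤ 2 / Real.pi := by
      rw [div_le_div_iff₀ (by norm_num) Real.pi_pos]
      linarith [Real.pi_le_four]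
    calc 1 / 2 * |θ - θ'| ≤ 2 / Real.pi * |θ - θ'| := by gcongr
      _ ≤ |Real.sin (θ - θ')| := Real.mul_abs_le_abs_sin (by linarith [Real.pi_gt_three])
  have hle := Complex.abs_im_le_norm ((ρ : ℂ) * Circle.exp (θ - θ') - ρ')
  rw [him, abs_mul, abs_of_pos (by linarith)] at hle
  rw [hrot, norm_mul, Circle.norm_coe, one_mul]
  nlinarith [abs_nonneg (θ - θ')]

theorem dist_le_dist_graphParam (hp : 0 < p) {q q' : ℂ × ℝ} (hq : ‖q.1‖ ^ (2 * p) ≤ 2 / 3)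
    (h : |q.2 - q'.2| ≤ 1) :
    dist q q' ≤ 6 * dist (graphParam p q) (graphParam p q') := by
  have hcoord : ∀ i, ‖graphParam p q i - graphParam p q' i‖ ≤
      dist (graphParam p q) (graphParam p q') := fun i => by
    rw [dist_eq_norm]
    exact PiLp.norm_apply_le (graphParam p q - graphParam p q') i
  have h0 : ‖q.1 - q'.1‖ ≤ _ := hcoord 0
  have hangle := abs_sub_le_norm_polar_sub
    (ρ' := (1 - ‖q'.1‖ ^ (2 * p)) ^ (1 / (2 * p : ℝ)))
    (third_le_rpow_one_sub hp (by positivity) hq) h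
  rw [Prod.dist_eq, dist_eq_norm, Real.dist_eq]
  refine max_le ?_ (hangle.trans ?_)
  · linarith [dist_nonneg (x := graphParam p q) (y := graphParam p q')]
  · gcongr
    exact hcoord 1

theorem antilipschitzWith_graphParam (hp : 0 < p) :
    AntilipschitzWith 6 ((sectorDomain p).domRestrict (graphParam p)) := by
  refine AntilipschitzWith.of_le_mul_dist fun q q' => ?_
  refine dist_le_dist_graphParam hp q.2.1 ?_
  have h := q.2.2
  have h' := q'.2.2
  rw [abs_le]
  constructor <;> linarith [h.1, h.2, h'.1, h'.2]

theorem comparable_map_graphParam (hp : 0 < p) :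
    Comparable ((volume.restrict (sectorDomain p)).map (graphParam p))
      ((μHE[3] : Measure C2).restrict (eggSector p)) := by
  obtain ⟨k, hk0, hk⟩ := exists_euclideanHausdorffMeasure_eq_smul_volume
  obtain ⟨K, hK⟩ := exists_lipschitzOnWith_graphParam hp
  have h := comparable_map_restrict_euclideanHausdorffMeasure (continuous_graphParam p).measurable
    hK (antilipschitzWith_graphParam hp) 3
  rw [hk, Measure.restrict_smul, Measure.map_smul] at h
  exact (Comparable.smul_left hk0 _).symm.trans h

theorem rpow_inv_two_mul_pow (hp : 0 < p) {t : ℝ} (ht : 0 ≤ t) :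
    (t ^ (1 / (2 * p : ℝ))) ^ (2 * p) = t := by
  have h : (1 / (2 * p : ℝ)) = ((2 * p : ℕ) : ℝ)⁻¹ := by push_cast; exact one_div _
  rw [h, Real.rpow_inv_natCast_pow ht (by omega)]

theorem eggRho_graphParam (hp : 0 < p) {q : ℂ × ℝ} (hq : ‖q.1‖ ^ (2 * p) ≤ 1) :
    eggRho p (graphParam p q) = 1 := by
  have h : 0 ≤ 1 - ‖q.1‖ ^ (2 * p) := by linarith
  rw [graphParam, eggRho_toLp, norm_mul, Circle.norm_coe, mul_one, Complex.norm_real,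
    Real.norm_of_nonneg (by positivity), rpow_inv_two_mul_pow hp h]
  ring

theorem exists_Ico_norm_mul_circle_exp_eq (w : ℂ) :
    ∃ θ ∈ Set.Ico 0 (2 * Real.pi), (‖w‖ : ℂ) * Circle.exp θ = w := by
  refine ⟨toIcoMod Real.two_pi_pos 0 w.arg, ?_, ?_⟩
  · simpa using toIcoMod_mem_Ico Real.two_pi_pos 0 w.arg
  · have h := exp_mul_toIcoMod_arg w 1
    rw [Nat.cast_one, one_mul, pow_one, mul_comm Complex.I] at h
    rw [Circle.coe_exp, h, Complex.norm_mul_exp_arg_mul_I]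

theorem exists_torusRotation_mem_eggSector (hp : 0 < p) {z : C2} (hz : eggRho p z = 1)
    (hs : radialCoord p z ≤ 2 / 3) :
    ∃ k ∈ Finset.range 7, torusRotation ![1, Circle.exp (-(k : ℕ))] z ∈ eggSector p := by
  obtain ⟨θ, ⟨h0, h1⟩, hθ⟩ := exists_Ico_norm_mul_circle_exp_eq (z 1)
  have hradius : (1 - ‖z 0‖ ^ (2 * p)) ^ (1 / (2 * p : ℝ)) = ‖z 1‖ := by
    have hpos : 0 ≤ 1 - ‖z 0‖ ^ (2 * p) := sub_nonneg.2 (radialCoord_le_one hz.le)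
    refine (pow_left_inj₀ (by positivity) (norm_nonneg _) (n := 2 * p) (by omega)).1 ?_
    rw [← one_sub_radialCoord hz, radialCoord, rpow_inv_two_mul_pow hp hpos]
  refine ⟨⌊θ⌋₊, ?_, (z 0, θ - ⌊θ⌋₊), ⟨hs, ?_, ?_⟩, ?_⟩
  · rw [Finset.mem_range, Nat.floor_lt h0]
    push_cast
    linarith [Real.pi_lt_d2]
  · exact sub_nonneg.2 (Nat.floor_le h0)
  · linarith [Nat.lt_floor_add_one θ]
  · ext i
    fin_cases i
    · simp [graphParam, torusRotation_apply]
    · change (((1 - ‖z 0‖ ^ (2 * p)) ^ (1 / (2 * p : ℝ)) : ℝ) : ℂ) * Circle.exp (θ - ⌊θ⌋₊) =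
        Circle.exp (-(⌊θ⌋₊ : ℝ)) * z 1
      rw [hradius, sub_eq_add_neg, Circle.exp_add, Circle.coe_mul, ← mul_assoc, hθ, mul_comm]

end Graph

/-! ### The radial image of the surface measure -/

theorem measurePreserving_withDensity {X : Type*} [MeasurableSpace X] {μ : Measure X} {e : X → X}
    (he : MeasurePreserving e μ μ) {g : X → ℝ≥0∞} (hg : Measurable g) (hinv : ∀ x, g (e x) = g x) :
    MeasurePreserving e (μ.withDensity g) (μ.withDensity g) := by
  refine ⟨he.measurable, Measure.ext fun s hs => ?_⟩
  rw [Measure.map_apply he.measurable hs, withDensity_apply _ (he.measurable hs),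
    withDensity_apply _ hs, ← he.setLIntegral_comp_preimage hs hg]
  simp only [hinv]

theorem lintegral_comp_norm_complex {g : ℝ → ℝ≥0∞} (hg : Measurable g) :
    ∫⁻ w : ℂ, g ‖w‖ = ENNReal.ofReal (2 * Real.pi) *
      ∫⁻ r in Set.Ioi (0 : ℝ), ENNReal.ofReal r * g r := by
  rw [← Complex.lintegral_comp_polarCoord_symm]
  simp only [Complex.norm_polarCoord_symm, polarCoord_target, smul_eq_mul]
  have hm : Measurable fun q : ℝ × ℝ => ENNReal.ofReal q.1 * g |q.1| := by fun_prop
  rw [Measure.volume_eq_prod, ← Measure.prod_restrict, lintegral_prod _ hm.aemeasurable]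
  simp only [lintegral_const, Measure.restrict_apply MeasurableSet.univ, Set.univ_inter,
    Real.volume_Ioo]
  rw [lintegral_mul_const _ (by fun_prop), mul_comm]
  congr 1
  · congr 1; ring
  · refine setLIntegral_congr_fun measurableSet_Ioi fun r hr => ?_
    simp only [abs_of_pos (show 0 < r from hr)]

section Radial

variable {p : ℕ} {α : ℝ}

theorem lintegral_Ioi_comp_pow (hp : 0 < p) (g : ℝ → ℝ≥0∞) :
    ∫⁻ r in Set.Ioi (0 : ℝ), ENNReal.ofReal r * g (r ^ (2 * p)) =
      ENNReal.ofReal (1 / (2 * p)) *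
        ∫⁻ s in Set.Ioi (0 : ℝ), ENNReal.ofReal (s ^ (1 / (p : ℝ) - 1)) * g s := by
  have : (0 : ℝ) < p := by exact_mod_cast hp
  set e : ℝ := 1 / (2 * p : ℝ) with he
  have he0 : 0 < e := by positivity
  have himg : (fun s : ℝ => s ^ e) '' Set.Ioi 0 = Set.Ioi 0 := by
    refine Set.Subset.antisymm (Set.image_subset_iff.2 fun s hs => Real.rpow_pos_of_pos hs _) ?_
    exact fun r hr => ⟨r ^ e⁻¹, Real.rpow_pos_of_pos hr _, Real.rpow_inv_rpow (le_of_lt hr) he0.ne'⟩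
  have hsubst := lintegral_image_eq_lintegral_abs_deriv_mul (s := Set.Ioi (0 : ℝ))
    (f := fun s : ℝ => s ^ e) (f' := fun s => e * s ^ (e - 1)) measurableSet_Ioi
    (fun s hs => (Real.hasDerivAt_rpow_const (Or.inl (ne_of_gt hs))).hasDerivWithinAt)
    (fun s hs t ht hst => (Real.rpow_left_inj (le_of_lt hs) (le_of_lt ht) he0.ne').1 hst)
    (fun r => ENNReal.ofReal r * g (r ^ (2 * p)))
  rw [himg] at hsubst
  rw [hsubst, ← lintegral_const_mul' _ _ ENNReal.ofReal_ne_top]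
  refine setLIntegral_congr_fun measurableSet_Ioi fun s hs => ?_
  have hs' : 0 < s := hs
  have hexp : s ^ (1 / (p : ℝ) - 1) = s ^ (e - 1) * s ^ e := by
    rw [← Real.rpow_add hs']
    congr 1
    rw [he]
    field_simp
    ring
  simp only [he, rpow_inv_two_mul_pow hp hs'.le]
  rw [← he, abs_of_nonneg (by positivity), hexp, ENNReal.ofReal_mul he0.le,
    ENNReal.ofReal_mul (by positivity)]
  ring

theorem exists_map_norm_pow_volume (hp : 0 < p) : ∃ c : NNReal, c ≠ 0 ∧
    (volume : Measure ℂ).map (fun w => ‖w‖ ^ (2 * p)) =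
      c • (volume.restrict (Set.Ioi 0)).withDensity
        fun s => ENNReal.ofReal (s ^ (1 / (p : ℝ) - 1)) := by
  have : (0 : ℝ) < p := by exact_mod_cast hp
  have := Real.pi_pos
  refine ⟨(2 * Real.pi).toNNReal * (1 / (2 * p : ℝ)).toNNReal, ?_, Measure.ext fun B hB => ?_⟩
  · exact mul_ne_zero (Real.toNNReal_pos.2 (by positivity)).ne'
      (Real.toNNReal_pos.2 (by positivity)).ne'
  · have hpow : Measurable fun w : ℂ => ‖w‖ ^ (2 * p) := by fun_prop
    have hpow' : Measurable fun r : ℝ => r ^ (2 * p) := by fun_prop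
    have hind : Measurable (B.indicator (1 : ℝ → ℝ≥0∞)) := measurable_one.indicator hB
    rw [← lintegral_indicator_one hB, lintegral_map hind hpow,
      lintegral_comp_norm_complex (g := fun r => B.indicator 1 (r ^ (2 * p))) (hind.comp hpow'),
      lintegral_Ioi_comp_pow hp, Measure.smul_apply, ← lintegral_indicator_one hB,
      lintegral_withDensity_eq_lintegral_mul _ (by fun_prop) hind, ENNReal.smul_def, smul_eq_mul,
      ENNReal.coe_mul, mul_assoc]
    rfl

theorem rpow_sub_one_le_three (h0 : 0 ≤ α) {s : ℝ} (hs : 1 / 3 ≤ s) (hs1 : s ≤ 1) :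
    s ^ (α - 1) ≤ 3 := by
  calc s ^ (α - 1) ≤ s ^ (-1 : ℝ) :=
        Real.rpow_le_rpow_of_exponent_ge (by linarith) hs1 (by linarith)
    _ = s⁻¹ := Real.rpow_neg_one _
    _ ≤ (1 / 3)⁻¹ := inv_anti₀ (by norm_num) hs
    _ = 3 := by norm_num

theorem comparable_rpow_restrict_radialMeasure (h0 : 0 ≤ α) (h1 : α ≤ 1) :
    Comparable (((volume.restrict (Set.Ioi 0)).withDensity
        fun s => ENNReal.ofReal (s ^ (α - 1))).restrict (Set.Iic (2 / 3)))
      ((radialMeasure α).restrict (Set.Iic (2 / 3))) := by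
  have hset : Set.Iic (2 / 3 : ℝ) ∩ Set.Ioo 0 1 = Set.Iic (2 / 3) ∩ Set.Ioi 0 := by
    ext s
    exact ⟨fun h => ⟨h.1, h.2.1⟩, fun h => ⟨h.1, h.2, lt_of_le_of_lt h.1 (by norm_num)⟩⟩
  rw [radialMeasure, restrict_withDensity measurableSet_Iic, restrict_withDensity measurableSet_Iic,
    Measure.restrict_restrict measurableSet_Iic, Measure.restrict_restrict measurableSet_Iic, hset]
  have hmeas : MeasurableSet (Set.Iic (2 / 3 : ℝ) ∩ Set.Ioi 0) :=
    measurableSet_Iic.inter measurableSet_Ioi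
  constructor
  · refine .withDensity_of_le (C := 1) ?_ (by fun_prop)
    filter_upwards [ae_restrict_mem hmeas] with s ⟨hs, hs0⟩
    have hs0 : 0 < s := hs0
    rw [ENNReal.coe_one, one_mul]
    refine ENNReal.ofReal_le_ofReal (le_mul_of_one_le_right (by positivity) ?_)
    exact Real.one_le_rpow_of_pos_of_le_one_of_nonpos (by linarith [Set.mem_Iic.1 hs])
      (by linarith) (by linarith)
  · refine .withDensity_of_le (C := 3) ?_ (by fun_prop)
    filter_upwards [ae_restrict_mem hmeas] with s ⟨hs, hs0⟩
    have hs0 : 0 < s := hs0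
    have hone : 0 ≤ 1 - s := by linarith [Set.mem_Iic.1 hs]
    rw [mul_comm, ENNReal.ofReal_mul (by positivity)]
    gcongr
    refine (ENNReal.ofReal_le_ofReal (rpow_sub_one_le_three h0 ?_ ?_)).trans_eq (by simp)
    · linarith [Set.mem_Iic.1 hs]
    · linarith

theorem comparable_map_radialCoord_restrict_eggSector (hp : 0 < p) :
    Comparable (((eggSigma p).restrict (eggSector p)).map (radialCoord p))
      ((radialMeasure (1 / p)).restrict (Set.Iic (2 / 3))) := by
  have hp' : (1 : ℝ) ≤ p := by exact_mod_cast hp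
  have hr := (continuous_radialCoord p).measurable
  have hsub : eggSector p ⊆ frontier (egg p) := by
    rw [frontier_egg hp]
    rintro _ ⟨q, hq, rfl⟩
    exact eggRho_graphParam hp (le_trans hq.1 (by norm_num))
  rw [eggSigma, surfaceMeasure, Measure.restrict_restrict_of_subset hsub]
  refine ((comparable_map_graphParam hp).symm.map hr).trans ?_
  obtain ⟨c, hc, hmap⟩ := exists_map_norm_pow_volume hp
  have hpow : Measurable fun w : ℂ => ‖w‖ ^ (2 * p) := by fun_prop
  have hdomain : ((volume.restrict (sectorDomain p)).map (graphParam p)).map (radialCoord p) =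
      ((volume : Measure ℂ).map fun w => ‖w‖ ^ (2 * p)).restrict (Set.Iic (2 / 3)) := by
    rw [Measure.map_map hr (continuous_graphParam p).measurable,
      Measure.restrict_map hpow measurableSet_Iic, sectorDomain, Measure.volume_eq_prod,
      ← Measure.prod_restrict]
    change Measure.map ((fun w : ℂ => ‖w‖ ^ (2 * p)) ∘ Prod.fst) _ = _
    rw [← Measure.map_map hpow measurable_fst, Measure.map_fst_prod]
    simp [Set.preimage]
  rw [hdomain, hmap, Measure.restrict_smul]
  refine (Comparable.smul_left hc _).trans (comparable_rpow_restrict_radialMeasure ?_ ?_)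
  · positivity
  · rw [div_le_one (by linarith)]; exact hp'

theorem measurePreserving_eggSigma (hp : 0 < p) (e : C2 ≃ᵢ C2)
    (he : ∀ z, eggRho p (e z) = eggRho p z) :
    MeasurePreserving e (eggSigma p) (eggSigma p) := by
  have h := (e.measurePreserving_euclideanHausdorffMeasure 3).restrict_preimage
    (s := frontier (egg p)) isClosed_frontier.measurableSet
  have hinv : e ⁻¹' frontier (egg p) = frontier (egg p) := by
    rw [frontier_egg hp]
    ext z
    simp [he]
  rwa [hinv] at h

theorem ae_eggSigma_eggRho_eq_one (hp : 0 < p) : ∀ᵐ z ∂eggSigma p, eggRho p z = 1 := by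
  have h : ∀ᵐ z ∂eggSigma p, z ∈ frontier (egg p) :=
    ae_restrict_mem isClosed_frontier.measurableSet
  rwa [frontier_egg hp] at h

theorem dominatedBy_eggSector (hp : 0 < p) :
    DominatedBy (((eggSigma p).map (radialCoord p)).restrict (Set.Iic (2 / 3)))
      (((eggSigma p).restrict (eggSector p)).map (radialCoord p)) := by
  have hr := (continuous_radialCoord p).measurable
  refine ⟨7, Measure.le_iff.2 fun B hB => ?_⟩
  set rot : ℕ → C2 ≃ᵢ C2 := fun k => torusRotation ![1, Circle.exp (-(k : ℕ))]
  have hcover : ∀ᵐ z ∂eggSigma p, z ∈ radialCoord p ⁻¹' (B ∩ Set.Iic (2 / 3)) →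
      z ∈ ⋃ k ∈ Finset.range 7, rot k ⁻¹' (radialCoord p ⁻¹' B ∩ eggSector p) := by
    filter_upwards [ae_eggSigma_eggRho_eq_one hp] with z hz hzB
    obtain ⟨k, hk, hmem⟩ := exists_torusRotation_mem_eggSector hp hz hzB.2
    refine Set.mem_biUnion hk ⟨?_, hmem⟩
    rw [Set.mem_preimage, radialCoord_torusRotation]
    exact hzB.1
  have hrot : ∀ k, eggSigma p (rot k ⁻¹' (radialCoord p ⁻¹' B ∩ eggSector p)) =
      eggSigma p (radialCoord p ⁻¹' B ∩ eggSector p) := fun k =>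
    (measurePreserving_eggSigma hp _ (eggRho_torusRotation p _)).measure_preimage
      ((hr hB).inter (measurableSet_eggSector hp)).nullMeasurableSet
  rw [Measure.restrict_apply hB, Measure.map_apply hr (hB.inter measurableSet_Iic),
    Measure.smul_apply, Measure.map_apply hr hB, Measure.restrict_apply (hr hB)]
  refine (measure_mono_ae hcover).trans ((measure_biUnion_finset_le _ _).trans_eq ?_)
  simp only [hrot, Finset.sum_const, Finset.card_range]
  rw [nsmul_eq_mul, ENNReal.smul_def, smul_eq_mul]
  rfl

theorem comparable_restrict_Iic (hp : 0 < p) :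
    Comparable (((eggSigma p).map (radialCoord p)).restrict (Set.Iic (2 / 3)))
      ((radialMeasure (1 / p)).restrict (Set.Iic (2 / 3))) := by
  have hr := (continuous_radialCoord p).measurable
  have hsector := comparable_map_radialCoord_restrict_eggSector hp
  refine ⟨(dominatedBy_eggSector hp).trans hsector.1, hsector.2.trans ?_⟩
  rw [Measure.restrict_map hr measurableSet_Iic]
  refine (DominatedBy.of_le (Measure.restrict_mono ?_ le_rfl)).map hr
  rintro _ ⟨q, hq, rfl⟩
  exact hq.1

theorem comparable_of_restrict_Iic {μ ν : Measure ℝ}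
    (hμ : MeasurePreserving (fun s => 1 - s) μ μ) (hν : MeasurePreserving (fun s => 1 - s) ν ν)
    (h : Comparable (μ.restrict (Set.Iic (2 / 3))) (ν.restrict (Set.Iic (2 / 3)))) :
    Comparable μ ν := by
  have hpre : (fun s : ℝ => 1 - s) ⁻¹' Set.Ici (1 / 3) = Set.Iic (2 / 3) := by
    ext s
    simp only [Set.mem_preimage, Set.mem_Ici, Set.mem_Iic]
    constructor <;> intro h <;> linarith
  have hIci : ∀ {ρ : Measure ℝ}, MeasurePreserving (fun s => 1 - s) ρ ρ →
      ρ.restrict (Set.Ici (1 / 3)) = (ρ.restrict (Set.Iic (2 / 3))).map fun s => 1 - s :=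
    fun {ρ} hρ => by
      rw [← hpre, ← Measure.restrict_map hρ.measurable measurableSet_Ici, hρ.map_eq]
  refine .of_union_eq_univ (s := Set.Iic (2 / 3)) (t := Set.Ici (1 / 3)) ?_ h ?_
  · exact Set.eq_univ_of_forall fun s => (le_total s (2 / 3)).imp id (le_trans (by norm_num))
  · rw [hIci hμ, hIci hν]
    exact h.map hμ.measurable

theorem measurePreserving_one_sub_radialMeasure (α : ℝ) :
    MeasurePreserving (fun s => 1 - s) (radialMeasure α) (radialMeasure α) := by
  refine measurePreserving_withDensity ?_ (by fun_prop) fun s => by rw [sub_sub_cancel, mul_comm]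
  have h := (Measure.measurePreserving_sub_left volume (1 : ℝ)).restrict_preimage
    (measurableSet_Ioo (a := (0 : ℝ)) (b := 1))
  simpa using h

theorem measurePreserving_one_sub_map_eggSigma (hp : 0 < p) :
    MeasurePreserving (fun s => 1 - s) ((eggSigma p).map (radialCoord p))
      ((eggSigma p).map (radialCoord p)) := by
  have hr := (continuous_radialCoord p).measurable
  have hswap := measurePreserving_eggSigma hp coordSwap (eggRho_coordSwap p)
  refine ⟨by fun_prop, ?_⟩
  calc ((eggSigma p).map (radialCoord p)).map (fun s => 1 - s)
      = (eggSigma p).map (radialCoord p ∘ coordSwap) := by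
        rw [Measure.map_map (by fun_prop) hr]
        exact Measure.map_congr ((ae_eggSigma_eggRho_eq_one hp).mono fun z => one_sub_radialCoord)
    _ = (eggSigma p).map (radialCoord p) := by
        rw [← Measure.map_map hr hswap.measurable, hswap.map_eq]

theorem isEggMeasure_eggSigma (hp : 0 < p) : IsEggMeasure p (1 / p) (eggSigma p) where
  order_pos := hp
  exponent_pos := by positivity
  eggRho_eq_one := ae_eggSigma_eggRho_eq_one hp
  measurePreserving_torusRotation u :=
    measurePreserving_eggSigma hp _ (eggRho_torusRotation p u)
  comparable_map := comparable_of_restrict_Iic (measurePreserving_one_sub_map_eggSigma hp)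
    (measurePreserving_one_sub_radialMeasure _) (comparable_restrict_Iic hp)

end Radial

/-! ### The forms `dᶜφ` and `ddᶜφ` -/

theorem I_smul_I_smul (v : C2) : Complex.I • Complex.I • v = -v := by
  rw [smul_smul, Complex.I_mul_I, neg_smul, one_smul]

theorem dc_apply (φ : C2 → ℝ) (z u : C2) : dc φ z ![u] = -fderiv ℝ φ z (Complex.I • u) := rfl

theorem differentiableAt_dc {φ : C2 → ℝ} {z : C2} (h : DifferentiableAt ℝ (fderiv ℝ φ) z) :
    DifferentiableAt ℝ (dc φ) z := by
  let L : (C2 →L[ℝ] ℝ) →ₗ[ℝ] (C2 [⋀^Fin 1]→L[ℝ] ℝ) :=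
    { toFun := fun f => ContinuousAlternatingMap.ofSubsingleton ℝ C2 ℝ 0
        (-f.comp ((Complex.I • ContinuousLinearMap.id ℂ C2).restrictScalars ℝ))
      map_add' := fun f g => by
        ext v
        simp [add_comm]
      map_smul' := fun c f => by
        ext v
        simp }
  exact (LinearMap.toContinuousLinearMap L).differentiableAt.comp z h

theorem ddc_apply {φ : C2 → ℝ} {z : C2} (h : DifferentiableAt ℝ (fderiv ℝ φ) z) (u v : C2) :
    ddc φ z ![u, v] = fderiv ℝ (fun x => fderiv ℝ φ x (Complex.I • u)) z v -
      fderiv ℝ (fun x => fderiv ℝ φ x (Complex.I • v)) z u := by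
  rw [ddc, extDeriv_apply (differentiableAt_dc h), Fin.sum_univ_two]
  have hremove₀ : (0 : Fin 2).removeNth ![u, v] = ![v] := by
    ext i; fin_cases i; rfl
  have hremove₁ : (1 : Fin 2).removeNth ![u, v] = ![u] := by
    ext i; fin_cases i; rfl
  simp only [hremove₀, hremove₁, dc_apply, fderiv_fun_neg, Fin.coe_ofNat_eq_mod, Nat.zero_mod,
    Nat.one_mod, pow_zero, pow_one, one_smul, neg_smul, neg_apply, Matrix.cons_val_zero,
    Matrix.cons_val_one]
  ring

theorem ddc_apply_I_smul {φ : C2 → ℝ} {z : C2} (h : DifferentiableAt ℝ (fderiv ℝ φ) z) (m : C2) :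
    ddc φ z ![m, Complex.I • m] = fderiv ℝ (fun x => fderiv ℝ φ x m) z m +
      fderiv ℝ (fun x => fderiv ℝ φ x (Complex.I • m)) z (Complex.I • m) := by
  rw [ddc_apply h]
  simp only [I_smul_I_smul, map_neg, fderiv_fun_neg, neg_apply]
  ring

theorem fderiv_eq_inner_realGrad (φ : C2 → ℝ) (z u : C2) :
    fderiv ℝ φ z u =
      inner ℝ (realGrad φ z 0) (u 0) + inner ℝ (realGrad φ z 1) (u 1) := by
  have hu : u = ∑ j, ((u j).re • EuclideanSpace.single j (1 : ℂ) +
      (u j).im • EuclideanSpace.single j Complex.I) := by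
    ext j
    fin_cases j <;> simp [Complex.re_add_im]
  conv_lhs => rw [hu]
  simp [realGrad, Complex.inner]

theorem fderiv_unitNormal (φ : C2 → ℝ) (z : C2) :
    fderiv ℝ φ z (unitNormal φ z) = ‖realGrad φ z‖ := by
  have hsq := EuclideanSpace.norm_sq_eq (realGrad φ z)
  rw [Fin.sum_univ_two] at hsq
  rw [unitNormal, map_smul, fderiv_eq_inner_realGrad, real_inner_self_eq_norm_sq,
    real_inner_self_eq_norm_sq, ← hsq, smul_eq_mul, pow_two, ← mul_assoc]
  exact inv_mul_mul_self _

theorem fderiv_complexTangent_unitNormal (φ : C2 → ℝ) (z : C2) :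
    fderiv ℝ φ z (complexTangent (unitNormal φ z)) = 0 := by
  rw [fderiv_eq_inner_realGrad]
  simp [complexTangent, unitNormal, Complex.inner]
  ring

theorem fderiv_I_smul_complexTangent_unitNormal (φ : C2 → ℝ) (z : C2) :
    fderiv ℝ φ z (Complex.I • complexTangent (unitNormal φ z)) = 0 := by
  rw [fderiv_eq_inner_realGrad]
  simp [complexTangent, unitNormal, Complex.inner]
  ring

theorem dcWedgeDdc_frame (φ : C2 → ℝ) (z : C2) :
    dcWedgeDdc φ z (Complex.I • unitNormal φ z) (complexTangent (unitNormal φ z))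
        (Complex.I • complexTangent (unitNormal φ z)) =
      ‖realGrad φ z‖ * ddc φ z ![complexTangent (unitNormal φ z),
        Complex.I • complexTangent (unitNormal φ z)] := by
  simp only [dcWedgeDdc, dc_apply, I_smul_I_smul, map_neg, neg_neg, fderiv_unitNormal,
    fderiv_complexTangent_unitNormal, fderiv_I_smul_complexTangent_unitNormal]
  ring

theorem norm_complexTangent_unitNormal_zero (φ : C2 → ℝ) (z : C2) :
    ‖complexTangent (unitNormal φ z) 0‖ = ‖realGrad φ z‖⁻¹ * ‖realGrad φ z 1‖ := by
  simp [complexTangent, unitNormal]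

theorem norm_complexTangent_unitNormal_one (φ : C2 → ℝ) (z : C2) :
    ‖complexTangent (unitNormal φ z) 1‖ = ‖realGrad φ z‖⁻¹ * ‖realGrad φ z 0‖ := by
  simp [complexTangent, unitNormal]

/-! ### The Monge–Ampère density of the egg -/

section Density

variable {p : ℕ} {z : C2}

theorem hasFDerivAt_norm_coord_pow (j : Fin 2) (n : ℕ) (z : C2) :
    HasFDerivAt (fun x : C2 => ‖x j‖ ^ (2 * n))
      ((n * ‖z j‖ ^ (2 * (n - 1)) * 2) • (innerSL ℝ (z j)).comp
        ((EuclideanSpace.proj j : C2 →L[ℂ] ℂ).restrictScalars ℝ)) z := by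
  have h := ((EuclideanSpace.proj j : C2 →L[ℂ] ℂ).restrictScalars ℝ).hasFDerivAt (x := z)
    |>.norm_sq.pow n
  simp only [ContinuousLinearMap.coe_restrictScalars', EuclideanSpace.coe_proj, ← pow_mul] at h
  refine h.congr_fderiv ?_
  ext v
  simp only [smul_apply, smul_eq_mul, nsmul_eq_mul, Nat.cast_ofNat]
  ring

/-- The numerator `∑ⱼ |zⱼ|^{2(p-1)} Re (z̄ⱼ uⱼ)` of `dφₚ(u)` at `z`, whose denominator is
`eggRho p z`. -/
def eggNum (p : ℕ) (u z : C2) : ℝ :=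
  ‖z 0‖ ^ (2 * (p - 1)) * inner ℝ (z 0) (u 0) + ‖z 1‖ ^ (2 * (p - 1)) * inner ℝ (z 1) (u 1)

theorem fderiv_eggExhaustion (hp : 0 < p) (hz : eggRho p z ≠ 0) (u : C2) :
    fderiv ℝ (eggExhaustion p) z u = (eggRho p z)⁻¹ * eggNum p u z := by
  have hp' : (p : ℝ) ≠ 0 := by exact_mod_cast hp.ne'
  have h : HasFDerivAt (eggExhaustion p) _ z :=
    (((hasFDerivAt_norm_coord_pow 0 p z).add (hasFDerivAt_norm_coord_pow 1 p z)).log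
      hz).const_mul (1 / (2 * p : ℝ))
  rw [h.fderiv]
  simp only [eggNum, eggRho, smul_apply, add_apply, ContinuousLinearMap.comp_apply,
    innerSL_apply_apply, ContinuousLinearMap.coe_restrictScalars', EuclideanSpace.coe_proj,
    smul_eq_mul, Pi.add_apply]
  field_simp

theorem fderiv_eggExhaustion_of_eggRho_eq_one (hp : 0 < p) (hz : eggRho p z = 1) (u : C2) :
    fderiv ℝ (eggExhaustion p) z u = eggNum p u z := by
  rw [fderiv_eggExhaustion hp (by simp [hz]), hz, inv_one, one_mul]

theorem differentiableAt_fderiv_eggExhaustion (hz : eggRho p z ≠ 0) :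
    DifferentiableAt ℝ (fderiv ℝ (eggExhaustion p)) z := by
  have h : ∀ j : Fin 2, ContDiff ℝ 2 fun x : C2 => ‖x j‖ ^ (2 * p) := fun j => by
    simp only [pow_mul]
    have hj : ContDiff ℝ 2 fun x : C2 => x j :=
      ((EuclideanSpace.proj j : C2 →L[ℂ] ℂ).restrictScalars ℝ).contDiff
    exact (hj.norm_sq ℝ).pow p
  have hφ : ContDiffAt ℝ 2 (eggExhaustion p) z :=
    contDiffAt_const.mul (((h 0).add (h 1)).contDiffAt.log hz)
  exact (hφ.fderiv_right (m := 1) (by norm_num)).differentiableAt (by norm_num)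

theorem fderiv_eggNum_self (p : ℕ) (u z : C2) :
    DifferentiableAt ℝ (eggNum p u) z ∧ fderiv ℝ (eggNum p u) z u =
      ‖z 0‖ ^ (2 * (p - 1)) * ‖u 0‖ ^ 2 +
        2 * ((p - 1 : ℕ) : ℝ) * ‖z 0‖ ^ (2 * (p - 1 - 1)) * inner ℝ (z 0) (u 0) ^ 2 +
      (‖z 1‖ ^ (2 * (p - 1)) * ‖u 1‖ ^ 2 +
        2 * ((p - 1 : ℕ) : ℝ) * ‖z 1‖ ^ (2 * (p - 1 - 1)) * inner ℝ (z 1) (u 1) ^ 2) := by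
  have hinner : ∀ j : Fin 2, HasFDerivAt (fun x : C2 => inner ℝ (x j) (u j))
      ((innerSL ℝ (u j)).comp ((EuclideanSpace.proj j : C2 →L[ℂ] ℂ).restrictScalars ℝ)) z :=
    fun j => by
      simp only [real_inner_comm (u j)]
      exact ((innerSL ℝ (u j)).comp
        ((EuclideanSpace.proj j : C2 →L[ℂ] ℂ).restrictScalars ℝ)).hasFDerivAt
  have h : HasFDerivAt (eggNum p u) _ z :=
    ((hasFDerivAt_norm_coord_pow 0 (p - 1) z).mul (hinner 0)).add
      ((hasFDerivAt_norm_coord_pow 1 (p - 1) z).mul (hinner 1))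
  refine ⟨h.differentiableAt, ?_⟩
  rw [h.fderiv]
  simp only [smul_apply, add_apply, ContinuousLinearMap.comp_apply, innerSL_apply_apply,
    smul_eq_mul, ContinuousLinearMap.coe_restrictScalars', EuclideanSpace.coe_proj,
    real_inner_self_eq_norm_sq]
  ring

theorem fderiv_fderiv_eggExhaustion (hp : 0 < p) (hz : eggRho p z = 1) {u : C2}
    (hu : eggNum p u z = 0) :
    fderiv ℝ (fun x => fderiv ℝ (eggExhaustion p) x u) z u = fderiv ℝ (eggNum p u) z u := by
  have hne : eggRho p z ≠ 0 := by simp [hz]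
  have hev : (fun x => fderiv ℝ (eggExhaustion p) x u) =ᶠ[𝓝 z]
      fun x => (eggRho p x)⁻¹ * eggNum p u x :=
    ((continuous_eggRho p).continuousAt.eventually_ne hne).mono fun x hx =>
      fderiv_eggExhaustion hp hx u
  have hρ : DifferentiableAt ℝ (fun x => (eggRho p x)⁻¹) z :=
    ((hasFDerivAt_norm_coord_pow 0 p z).add
      (hasFDerivAt_norm_coord_pow 1 p z)).differentiableAt.inv hne
  rw [hev.fderiv_eq, fderiv_fun_mul hρ (fderiv_eggNum_self p u z).1, hz, hu]
  simp

theorem inner_sq_add_inner_I_mul_sq (a b : ℂ) :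
    (inner ℝ a b : ℝ) ^ 2 + (inner ℝ a (Complex.I * b) : ℝ) ^ 2 = ‖a‖ ^ 2 * ‖b‖ ^ 2 := by
  rw [← Complex.normSq_eq_norm_sq, ← Complex.normSq_eq_norm_sq, Complex.normSq_apply,
    Complex.normSq_apply]
  simp only [Complex.inner, Complex.mul_re, Complex.mul_im, Complex.conj_re, Complex.conj_im,
    Complex.I_re, Complex.I_im]
  ring

theorem ddc_eggExhaustion (hp : 0 < p) (hz : eggRho p z = 1) {m : C2}
    (hm : eggNum p m z = 0) (hIm : eggNum p (Complex.I • m) z = 0) :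
    ddc (eggExhaustion p) z ![m, Complex.I • m] =
      2 * p * (‖z 0‖ ^ (2 * (p - 1)) * ‖m 0‖ ^ 2 + ‖z 1‖ ^ (2 * (p - 1)) * ‖m 1‖ ^ 2) := by
  have hpyth₀ := inner_sq_add_inner_I_mul_sq (z 0) (m 0)
  have hpyth₁ := inner_sq_add_inner_I_mul_sq (z 1) (m 1)
  rw [ddc_apply_I_smul (differentiableAt_fderiv_eggExhaustion (by simp [hz])),
    fderiv_fderiv_eggExhaustion hp hz hm, fderiv_fderiv_eggExhaustion hp hz hIm,
    (fderiv_eggNum_self p _ z).2, (fderiv_eggNum_self p _ z).2]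
  simp only [PiLp.smul_apply, smul_eq_mul, norm_mul, Complex.norm_I, one_mul]
  obtain ⟨q, rfl⟩ : ∃ q, p = q + 1 := ⟨p - 1, by omega⟩
  rcases q with _ | q
  · simp
    ring
  · simp only [Nat.add_sub_cancel]
    push_cast
    linear_combination 2 * ((q : ℝ) + 1) * ‖z 0‖ ^ (2 * q) * hpyth₀ +
      2 * ((q : ℝ) + 1) * ‖z 1‖ ^ (2 * q) * hpyth₁

theorem norm_realGrad_eggExhaustion_apply (hp : 0 < p) (hz : eggRho p z = 1) (j : Fin 2) :
    ‖realGrad (eggExhaustion p) z j‖ = ‖z j‖ ^ (2 * p - 1) := by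
  have hgrad : realGrad (eggExhaustion p) z j = ((‖z j‖ ^ (2 * (p - 1)) : ℝ) : ℂ) * z j := by
    simp only [realGrad, fderiv_eggExhaustion_of_eggRho_eq_one hp hz, eggNum]
    apply Complex.ext <;> fin_cases j <;> simp [Complex.inner, -Complex.ofReal_pow]
  rw [hgrad, norm_mul, Complex.norm_real, Real.norm_of_nonneg (by positivity), ← pow_succ]
  congr 1
  omega

/-- The value of the Monge–Ampère density of `φₚ` with respect to surface area on `b𝓔ₚ`; the
denominator is the norm of the gradient of `φₚ`. -/
def eggDensity (p : ℕ) (z : C2) : ℝ :=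
  2 * p * (‖z 0‖ * ‖z 1‖) ^ (2 * (p - 1)) /
    √((‖z 0‖ ^ (2 * p - 1)) ^ 2 + (‖z 1‖ ^ (2 * p - 1)) ^ 2)

theorem norm_realGrad_eggExhaustion (hp : 0 < p) (hz : eggRho p z = 1) :
    ‖realGrad (eggExhaustion p) z‖ =
      √((‖z 0‖ ^ (2 * p - 1)) ^ 2 + (‖z 1‖ ^ (2 * p - 1)) ^ 2) := by
  rw [EuclideanSpace.norm_eq, Fin.sum_univ_two, norm_realGrad_eggExhaustion_apply hp hz,
    norm_realGrad_eggExhaustion_apply hp hz]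

theorem sqrt_gradSq_mem_Icc (hp : 0 < p) (hz : eggRho p z = 1) :
    √((‖z 0‖ ^ (2 * p - 1)) ^ 2 + (‖z 1‖ ^ (2 * p - 1)) ^ 2) ∈ Set.Icc (1 / 2) 2 := by
  have hlower : ∀ j, ‖z j‖ ^ (2 * p) ≤ ‖z j‖ ^ (2 * p - 1) := fun j =>
    pow_le_pow_of_le_one (norm_nonneg _) (norm_coord_le_one hp hz.le j) (by omega)
  have hupper : ∀ j, (‖z j‖ ^ (2 * p - 1)) ^ 2 ≤ 1 := fun j =>
    pow_le_one₀ (by positivity) (pow_le_one₀ (norm_nonneg _) (norm_coord_le_one hp hz.le j))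
  have hsum : 1 ≤ ‖z 0‖ ^ (2 * p - 1) + ‖z 1‖ ^ (2 * p - 1) :=
    hz.symm.le.trans (add_le_add (hlower 0) (hlower 1))
  refine ⟨Real.le_sqrt_of_sq_le ?_, Real.sqrt_le_iff.2 ⟨by norm_num, ?_⟩⟩
  · nlinarith [sq_nonneg (‖z 0‖ ^ (2 * p - 1) - ‖z 1‖ ^ (2 * p - 1))]
  · linarith [hupper 0, hupper 1]

theorem dcWedgeDdc_eggExhaustion (hp : 0 < p) (hz : eggRho p z = 1) :
    dcWedgeDdc (eggExhaustion p) z (Complex.I • unitNormal (eggExhaustion p) z)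
      (complexTangent (unitNormal (eggExhaustion p) z))
      (Complex.I • complexTangent (unitNormal (eggExhaustion p) z)) = eggDensity p z := by
  have htangent := fderiv_complexTangent_unitNormal (eggExhaustion p) z
  have hItangent := fderiv_I_smul_complexTangent_unitNormal (eggExhaustion p) z
  rw [fderiv_eggExhaustion_of_eggRho_eq_one hp hz] at htangent hItangent
  have hpos := one_half_pos.trans_le (sqrt_gradSq_mem_Icc hp hz).1
  rw [dcWedgeDdc_frame, ddc_eggExhaustion hp hz htangent hItangent,
    norm_complexTangent_unitNormal_zero, norm_complexTangent_unitNormal_one,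
    norm_realGrad_eggExhaustion_apply hp hz, norm_realGrad_eggExhaustion_apply hp hz,
    norm_realGrad_eggExhaustion hp hz, eggDensity]
  set G := √((‖z 0‖ ^ (2 * p - 1)) ^ 2 + (‖z 1‖ ^ (2 * p - 1)) ^ 2)
  have hsum : ‖z 0‖ ^ (2 * p) + ‖z 1‖ ^ (2 * p) = 1 := hz
  obtain ⟨q, rfl⟩ : ∃ q, p = q + 1 := ⟨p - 1, by omega⟩
  simp only [Nat.add_sub_cancel, show 2 * (q + 1) - 1 = 2 * q + 1 by omega]
  field_simp
  linear_combination ‖z 0‖ ^ (2 * q) * ‖z 1‖ ^ (2 * q) * hsum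

theorem eggDensity_bounds (hp : 0 < p) (hz : eggRho p z = 1) :
    p * (‖z 0‖ * ‖z 1‖) ^ (2 * (p - 1)) ≤ eggDensity p z ∧
      eggDensity p z ≤ 4 * p * (‖z 0‖ * ‖z 1‖) ^ (2 * (p - 1)) := by
  obtain ⟨hlower, hupper⟩ := sqrt_gradSq_mem_Icc hp hz
  have hnonneg : 0 ≤ p * (‖z 0‖ * ‖z 1‖) ^ (2 * (p - 1)) := by positivity
  rw [eggDensity, le_div_iff₀ (by linarith), div_le_iff₀ (by linarith)]
  constructor <;> nlinarith

theorem measurable_eggDensity (p : ℕ) : Measurable (eggDensity p) := by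
  have h : ∀ j : Fin 2, Measurable fun z : C2 => ‖z j‖ := fun j =>
    Continuous.measurable (by fun_prop)
  have := h 0
  have := h 1
  unfold eggDensity
  fun_prop

theorem eggOmega_eq_withDensity (hp : 0 < p) :
    eggOmega p = (eggSigma p).withDensity fun z => ENNReal.ofReal (eggDensity p z) :=
  withDensity_congr_ae <| (ae_eggSigma_eggRho_eq_one hp).mono fun _ hz =>
    congrArg ENNReal.ofReal (dcWedgeDdc_eggExhaustion hp hz)

theorem eggDensity_torusRotation (p : ℕ) (u : Fin 2 → Circle) (z : C2) :
    eggDensity p (torusRotation u z) = eggDensity p z := by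
  simp only [eggDensity, torusRotation_apply, norm_mul, Circle.norm_coe, one_mul]

theorem ae_radialCoord_mem_Ioo {ν : Measure C2} {α : ℝ} (hν : IsEggMeasure p α ν) :
    ∀ᵐ z ∂ν, radialCoord p z ∈ Set.Ioo 0 1 := by
  have hac := hν.comparable_map.1.absolutelyContinuous.trans (radialMeasure_absolutelyContinuous α)
  exact ae_of_ae_map (continuous_radialCoord p).aemeasurable
    (hac.ae_le (ae_restrict_mem measurableSet_Ioo))

theorem norm_mul_norm_pow_eq (hp : 0 < p) (hz : eggRho p z = 1) :
    (‖z 0‖ * ‖z 1‖) ^ (2 * (p - 1)) =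
      (radialCoord p z * (1 - radialCoord p z)) ^ (1 - 1 / (p : ℝ)) := by
  rw [one_sub_radialCoord hz, radialCoord, ← mul_pow, ← Real.rpow_natCast, ← Real.rpow_natCast,
    ← Real.rpow_mul (by positivity)]
  congr 1
  push_cast [Nat.cast_sub hp]
  field_simp

theorem radialMeasure_withDensity_rpow (α β : ℝ) :
    (radialMeasure α).withDensity (fun s => ENNReal.ofReal ((s * (1 - s)) ^ (β - α))) =
      radialMeasure β := by
  rw [radialMeasure, ← withDensity_mul _ (by fun_prop) (by fun_prop)]
  refine withDensity_congr_ae ((ae_restrict_mem measurableSet_Ioo).mono fun s hs => ?_)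
  have hs0 : 0 < s := hs.1
  have hs1 : 0 < 1 - s := sub_pos.2 hs.2
  simp only [Pi.mul_apply]
  rw [← ENNReal.ofReal_mul (by positivity), ← Real.mul_rpow hs0.le hs1.le,
    ← Real.mul_rpow hs0.le hs1.le, ← Real.rpow_add (by positivity)]
  congr 2
  ring

theorem map_withDensity_comp {X Y : Type*} [MeasurableSpace X] [MeasurableSpace Y] (μ : Measure X)
    {f : X → Y} (hf : Measurable f) {g : Y → ℝ≥0∞} (hg : Measurable g) :
    (μ.withDensity (g ∘ f)).map f = (μ.map f).withDensity g := by
  ext s hs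
  rw [Measure.map_apply hf hs, withDensity_apply _ (hf hs), withDensity_apply _ hs,
    setLIntegral_map hs hg hf]
  rfl

theorem comparable_eggOmega (hp : 0 < p) : Comparable (eggOmega p)
    ((eggSigma p).withDensity fun z => ENNReal.ofReal ((‖z 0‖ * ‖z 1‖) ^ (2 * (p - 1)))) := by
  have hnorm : ∀ j : Fin 2, Measurable fun z : C2 => ‖z j‖ := fun j =>
    Continuous.measurable (by fun_prop)
  rw [eggOmega_eq_withDensity hp]
  constructor
  · refine .withDensity_of_le (C := 4 * p) ?_
      (((hnorm 0).mul (hnorm 1)).pow_const _).ennreal_ofReal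
    filter_upwards [ae_eggSigma_eggRho_eq_one hp] with z hz
    refine (ENNReal.ofReal_le_ofReal (eggDensity_bounds hp hz).2).trans_eq ?_
    rw [ENNReal.ofReal_mul (by positivity), ENNReal.ofReal_mul (by norm_num)]
    simp
  · refine .withDensity_of_le (C := 1) ?_ (measurable_eggDensity p).ennreal_ofReal
    filter_upwards [ae_eggSigma_eggRho_eq_one hp] with z hz
    rw [ENNReal.coe_one, one_mul]
    refine ENNReal.ofReal_le_ofReal ((le_mul_of_one_le_left ?_ ?_).trans
      (eggDensity_bounds hp hz).1)
    · positivity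
    · exact_mod_cast hp

theorem isEggMeasure_eggOmega (hp : 0 < p) : IsEggMeasure p 1 (eggOmega p) where
  order_pos := hp
  exponent_pos := one_pos
  eggRho_eq_one := by
    rw [eggOmega_eq_withDensity hp]
    exact (withDensity_absolutelyContinuous _ _).ae_le (ae_eggSigma_eggRho_eq_one hp)
  measurePreserving_torusRotation u := by
    rw [eggOmega_eq_withDensity hp]
    exact measurePreserving_withDensity
      ((isEggMeasure_eggSigma hp).measurePreserving_torusRotation u)
      (measurable_eggDensity p).ennreal_ofReal
      fun z => congrArg ENNReal.ofReal (eggDensity_torusRotation p u z)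
  comparable_map := by
    have hr := (continuous_radialCoord p).measurable
    have hdensity : (eggSigma p).withDensity
        (fun z => ENNReal.ofReal ((‖z 0‖ * ‖z 1‖) ^ (2 * (p - 1)))) =
        (eggSigma p).withDensity
          ((fun s => ENNReal.ofReal ((s * (1 - s)) ^ (1 - 1 / (p : ℝ)))) ∘ radialCoord p) :=
      withDensity_congr_ae ((ae_eggSigma_eggRho_eq_one hp).mono fun z hz =>
        congrArg ENNReal.ofReal (norm_mul_norm_pow_eq hp hz))
    refine ((comparable_eggOmega hp).map hr).trans ?_
    rw [hdensity, map_withDensity_comp _ hr (by fun_prop),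
      ← radialMeasure_withDensity_rpow (1 / p)]
    exact (isEggMeasure_eggSigma hp).comparable_map.withDensity _

theorem dominatedBy_eggOmega_eggSigma (hp : 0 < p) : DominatedBy (eggOmega p) (eggSigma p) := by
  have hle : (eggSigma p).withDensity
      (fun z => ENNReal.ofReal ((‖z 0‖ * ‖z 1‖) ^ (2 * (p - 1)))) ≤ eggSigma p := by
    conv_rhs => rw [← withDensity_one (μ := eggSigma p)]
    refine withDensity_mono ((ae_eggSigma_eggRho_eq_one hp).mono fun z hz => ?_)
    have hnorm := norm_coord_le_one hp hz.le
    exact ENNReal.ofReal_le_one.2 (pow_le_one₀ (by positivity)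
      (mul_le_one₀ (hnorm 0) (norm_nonneg _) (hnorm 1)))
  exact (comparable_eggOmega hp).1.trans (.of_le hle)

theorem dominatedBy_eggSigma_one_eggOmega_one : DominatedBy (eggSigma 1) (eggOmega 1) := by
  simpa using (comparable_eggOmega one_pos).2

theorem eggSigma_absolutelyContinuous_eggOmega (hp : 0 < p) : eggSigma p ≪ eggOmega p := by
  have hmeas : Measurable fun z : C2 => ENNReal.ofReal ((‖z 0‖ * ‖z 1‖) ^ (2 * (p - 1))) :=
    (Continuous.measurable (by fun_prop)).ennreal_ofReal
  refine .trans (withDensity_absolutelyContinuous' hmeas.aemeasurable ?_)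
    (comparable_eggOmega hp).2.absolutelyContinuous
  filter_upwards [ae_eggSigma_eggRho_eq_one hp,
    ae_radialCoord_mem_Ioo (isEggMeasure_eggSigma hp)] with z hz hs
  have hpos : 0 < radialCoord p z * (1 - radialCoord p z) := mul_pos hs.1 (sub_pos.2 hs.2)
  rw [norm_mul_norm_pow_eq hp hz]
  exact (ENNReal.ofReal_pos.2 (Real.rpow_pos_of_pos hpos _)).ne'

end Density

/-! ### Comparison of the two Hardy spaces -/

section Comparison

variable {p : ℕ}

theorem IsEggSeries.congr_ae {ν : Measure C2} {a : ℕ × ℕ → ℂ} {f g : C2 → ℂ}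
    (h : IsEggSeries p ν a f) (hfg : f =ᵐ[ν] g) : IsEggSeries p ν a g :=
  Tendsto.congr (fun _ => eLpNorm_congr_ae (hfg.mono fun _ hz => by rw [hz])) h

theorem IsEggSeries.of_dominatedBy {μ ν : Measure C2} {a : ℕ × ℕ → ℂ} {f : C2 → ℂ}
    (h : IsEggSeries p μ a f) (hle : DominatedBy ν μ) : IsEggSeries p ν a f := by
  obtain ⟨C, hC⟩ := hle
  have hfactor : (C : ℝ≥0∞) ^ (1 / (2 : ℝ≥0∞).toReal) ≠ ∞ :=
    ENNReal.rpow_ne_top_of_nonneg (by simp) ENNReal.coe_ne_top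
  have hzero := ENNReal.Tendsto.const_mul h (Or.inr hfactor)
  rw [mul_zero] at hzero
  refine tendsto_of_tendsto_of_tendsto_of_le_of_le tendsto_const_nhds hzero (fun _ => zero_le)
    fun S => (eLpNorm_mono_measure _ hC).trans_eq ?_
  change eLpNorm _ 2 ((C : ℝ≥0∞) • μ) = _
  rw [eLpNorm_smul_measure_of_ne_top (by simp), smul_eq_mul]
  simp

namespace IsEggMeasure

variable {α β : ℝ} {μ ν : Measure C2}

theorem summable_of_isEggSeries (hν : IsEggMeasure p α ν) {a : ℕ × ℕ → ℂ} {f : Lp ℂ 2 ν}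
    (h : IsEggSeries p ν a f) : Summable fun x : ℕ × ℕ =>
      ‖a x‖ ^ 2 * eulerBeta ((x.1 : ℝ) / p + α) ((x.2 : ℝ) / p + α) :=
  (hν.summable_smul_monomialLp_iff a).1 ((hν.isEggSeries_iff_hasSum a f).1 h).summable

theorem mem_hardyFunctions_iff (hν : IsEggMeasure p α ν) (f : C2 → ℂ) :
    f ∈ hardyFunctions (egg p) ν ↔ MemLp f 2 ν ∧ ∃ a, IsEggSeries p ν a f := by
  simp only [hardyFunctions, hν.hardySpace_eq, Set.mem_ofPred_eq]
  constructor
  · rintro ⟨hf, a, -, hseries⟩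
    exact ⟨hf, a, hseries.congr_ae hf.coeFn_toLp⟩
  · rintro ⟨hf, a, hseries⟩
    have h := hseries.congr_ae hf.coeFn_toLp.symm
    exact ⟨hf, a, hν.summable_of_isEggSeries h, h⟩

theorem eq_of_isEggSeries (hν : IsEggMeasure p α ν) {a b : ℕ × ℕ → ℂ} {f : Lp ℂ 2 ν}
    (ha : IsEggSeries p ν a f) (hb : IsEggSeries p ν b f) : a = b :=
  eq_of_hasSum_of_orthogonal hν.pairwise_inner_monomialLp hν.monomialLp_ne_zero
    ((hν.isEggSeries_iff_hasSum a f).1 ha) ((hν.isEggSeries_iff_hasSum b f).1 hb)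

theorem hardyFunctions_subset (hμ : IsEggMeasure p α μ) (hν : IsEggMeasure p β ν)
    (hle : DominatedBy ν μ) : hardyFunctions (egg p) μ ⊆ hardyFunctions (egg p) ν := by
  intro f hf
  obtain ⟨hmem, a, hseries⟩ := (hμ.mem_hardyFunctions_iff f).1 hf
  obtain ⟨C, hC⟩ := id hle
  exact (hν.mem_hardyFunctions_iff f).2
    ⟨hmem.of_measure_le_smul ENNReal.coe_ne_top hC, a, hseries.of_dominatedBy hle⟩

end IsEggMeasure

open ProbabilityTheory in
theorem eulerBeta_eq_beta {x y : ℝ} (hx : 0 < x) (hy : 0 < y) : eulerBeta x y = beta x y := by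
  have hcomplex : Complex.betaIntegral x y = (eulerBeta x y : ℂ) := by
    rw [Complex.betaIntegral, eulerBeta, ← intervalIntegral.integral_ofReal]
    refine intervalIntegral.integral_congr fun s hs => ?_
    rw [Set.uIcc_of_le zero_le_one] at hs
    have hs1 : 0 ≤ 1 - s := sub_nonneg.2 hs.2
    push_cast [Complex.ofReal_cpow hs.1, Complex.ofReal_cpow hs1]
    rfl
  rw [beta_eq_betaIntegralReal x y hx hy, hcomplex, Complex.ofReal_re]

theorem eulerBeta_one_left {y : ℝ} (hy : 0 < y) : eulerBeta 1 y = 1 / y := by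
  rw [eulerBeta_eq_beta one_pos hy, ProbabilityTheory.beta, Real.Gamma_one, add_comm,
    Real.Gamma_add_one hy.ne', one_mul, div_mul_cancel_right₀ (Real.Gamma_pos_of_pos hy).ne',
    one_div]

theorem Gamma_mul_rpow_neg_le_eulerBeta {x y : ℝ} (hx : 0 < x) (hx1 : x < 1) (hy : 0 < y) :
    Real.Gamma x * y ^ (-x) ≤ eulerBeta x y := by
  have := Real.Gamma_pos_of_pos hx
  have hΓy := Real.Gamma_pos_of_pos hy
  have hconvex : Real.Gamma (x + y) ≤ Real.Gamma y * y ^ x := by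
    have h := Real.Gamma_mul_add_mul_le_rpow_Gamma_mul_rpow_Gamma hy (by positivity : 0 < y + 1)
      (sub_pos.2 hx1) hx (by ring)
    rwa [show (1 - x) * y + x * (y + 1) = x + y by ring, Real.Gamma_add_one hy.ne',
      Real.mul_rpow hy.le hΓy.le, mul_left_comm, ← Real.rpow_add hΓy, sub_add_cancel,
      Real.rpow_one, mul_comm] at h
  rw [eulerBeta_eq_beta hx hy, ProbabilityTheory.beta, Real.rpow_neg hy.le,
    le_div_iff₀ (Real.Gamma_pos_of_pos (by positivity))]
  calc Real.Gamma x * (y ^ x)⁻¹ * Real.Gamma (x + y)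
      ≤ Real.Gamma x * (y ^ x)⁻¹ * (Real.Gamma y * y ^ x) := by gcongr
    _ = Real.Gamma x * Real.Gamma y := by field_simp

/-- Coefficients supported on `j = 0` with `|a_{0,ℓ}|² = (ℓ + 1)^{-(1 - 1/p)}`. Along `j = 0` the
weights of `ωₚ` and of `σ` decay like `ℓ⁻¹` and `ℓ^{-1/p}` respectively, so that these coefficients
separate the two spaces. -/
def separatingCoeff (p : ℕ) (x : ℕ × ℕ) : ℂ :=
  if x.1 = 0 then (((x.2 + 1 : ℕ) : ℝ) ^ (-(1 - 1 / (p : ℝ)) / 2) : ℝ) else 0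

theorem norm_sq_separatingCoeff (p l : ℕ) :
    ‖separatingCoeff p (0, l)‖ ^ 2 = ((l + 1 : ℕ) : ℝ) ^ (-(1 - 1 / (p : ℝ))) := by
  rw [separatingCoeff, if_pos rfl, Complex.norm_real, Real.norm_of_nonneg (by positivity),
    ← Real.rpow_natCast, ← Real.rpow_mul (by positivity)]
  congr 1
  push_cast
  ring

theorem summable_separatingCoeff_iff (w : ℕ × ℕ → ℝ) :
    (Summable fun x => ‖separatingCoeff p x‖ ^ 2 * w x) ↔
      Summable fun l : ℕ => ((l + 1 : ℕ) : ℝ) ^ (-(1 - 1 / (p : ℝ))) * w (0, l) := by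
  have hinj : Function.Injective fun l : ℕ => ((0, l) : ℕ × ℕ) := Prod.mk_right_injective 0
  rw [← hinj.summable_iff]
  · simp only [Function.comp_def, norm_sq_separatingCoeff]
  · rintro ⟨j, l⟩ h
    have hj : j ≠ 0 := fun hj => h ⟨l, by rw [hj]⟩
    simp [separatingCoeff, hj]

theorem omegaSummable_separatingCoeff (hp : 1 < p) : OmegaSummable p (separatingCoeff p) := by
  have hp' : (1 : ℝ) < p := by exact_mod_cast hp
  have hexp : -(2 - 1 / (p : ℝ)) < -1 := by
    linarith [(div_lt_one (by positivity)).2 hp']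
  refine (summable_separatingCoeff_iff _).2 <| Summable.of_nonneg_of_le (fun l => ?_) (fun l => ?_)
    (((summable_nat_add_iff 1).2 (Real.summable_nat_rpow.2 hexp)).mul_left (p : ℝ))
  · have := eulerBeta_pos (x := (0 : ℕ) / p + 1) (y := l / p + 1) (by positivity) (by positivity)
    positivity
  have hl : (0 : ℝ) < (l + 1 : ℕ) := by positivity
  have hweight : eulerBeta ((0 : ℕ) / p + 1) (l / p + 1) ≤ p * ((l + 1 : ℕ) : ℝ) ^ (-1 : ℝ) := by
    rw [Nat.cast_zero, zero_div, zero_add, eulerBeta_one_left (by positivity), Real.rpow_neg_one,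
      ← div_eq_mul_inv, div_le_div_iff₀ (by positivity) hl, mul_add,
      mul_div_cancel₀ _ (by positivity)]
    push_cast
    linarith
  calc ((l + 1 : ℕ) : ℝ) ^ (-(1 - 1 / (p : ℝ))) * eulerBeta ((0 : ℕ) / p + 1) (l / p + 1)
      ≤ ((l + 1 : ℕ) : ℝ) ^ (-(1 - 1 / (p : ℝ))) * (p * ((l + 1 : ℕ) : ℝ) ^ (-1 : ℝ)) := by
        gcongr
    _ = p * ((l + 1 : ℕ) : ℝ) ^ (-(2 - 1 / (p : ℝ))) := by
        rw [mul_left_comm, ← Real.rpow_add hl]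
        congr 2
        ring

theorem not_sigmaSummable_separatingCoeff (hp : 1 < p) :
    ¬ SigmaSummable p (separatingCoeff p) := by
  have hp' : (1 : ℝ) < p := by exact_mod_cast hp
  have hΓ : 0 < Real.Gamma (1 / p) := Real.Gamma_pos_of_pos (by positivity)
  intro h
  have hsum := ((summable_separatingCoeff_iff _).1 h).mul_left (Real.Gamma (1 / p))⁻¹
  suffices hharmonic : Summable fun l : ℕ => ((l + 1 : ℕ) : ℝ) ^ (-1 : ℝ) from
    lt_irrefl _ (Real.summable_nat_rpow.1 ((summable_nat_add_iff 1).1 hharmonic))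
  refine hsum.of_nonneg_of_le (fun l => by positivity) fun l => ?_
  have hl : (0 : ℝ) < (l + 1 : ℕ) := by positivity
  have hweight : Real.Gamma (1 / p) * ((l + 1 : ℕ) : ℝ) ^ (-(1 / p : ℝ)) ≤
      eulerBeta (((0 : ℕ) + 1) / p) ((l + 1) / p) := by
    rw [Nat.cast_zero, zero_add, ← Nat.cast_add_one]
    refine le_trans ?_ (Gamma_mul_rpow_neg_le_eulerBeta (by positivity)
      ((div_lt_one (by positivity)).2 hp') (by positivity))
    refine mul_le_mul_of_nonneg_left ?_ hΓ.le
    exact Real.rpow_le_rpow_of_nonpos (by positivity) (div_le_self hl.le hp'.le)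
      (neg_nonpos.2 (by positivity))
  calc ((l + 1 : ℕ) : ℝ) ^ (-1 : ℝ)
      = (Real.Gamma (1 / p))⁻¹ * (((l + 1 : ℕ) : ℝ) ^ (-(1 - 1 / (p : ℝ))) *
          (Real.Gamma (1 / p) * ((l + 1 : ℕ) : ℝ) ^ (-(1 / p : ℝ)))) := by
        rw [mul_left_comm _ (Real.Gamma _), inv_mul_cancel_left₀ hΓ.ne', ← Real.rpow_add hl]
        congr 1
        ring
    _ ≤ _ := by gcongr

theorem sigmaSummable_iff (a : ℕ × ℕ → ℂ) : SigmaSummable p a ↔ Summable fun x : ℕ × ℕ =>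
    ‖a x‖ ^ 2 * eulerBeta ((x.1 : ℝ) / p + 1 / p) ((x.2 : ℝ) / p + 1 / p) := by
  simp only [SigmaSummable, add_div]

theorem hardyFunctions_ssubset (hp : 1 < p) :
    hardyFunctions (egg p) (eggSigma p) ⊂ hardyFunctions (egg p) (eggOmega p) := by
  have hp0 : 0 < p := by omega
  have hσ := isEggMeasure_eggSigma hp0
  have hω := isEggMeasure_eggOmega hp0
  have hle := dominatedBy_eggOmega_eggSigma hp0
  obtain ⟨f, hf⟩ := hω.exists_isEggSeries (omegaSummable_separatingCoeff hp)
  refine Set.ssubset_iff_exists.2 ⟨hσ.hardyFunctions_subset hω hle, f,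
    (hω.mem_hardyFunctions_iff f).2 ⟨Lp.memLp f, _, hf⟩, fun hmem => ?_⟩
  obtain ⟨hfσ, b, hb⟩ := (hσ.mem_hardyFunctions_iff f).1 hmem
  obtain rfl : b = separatingCoeff p := hω.eq_of_isEggSeries (hb.of_dominatedBy hle) hf
  exact not_sigmaSummable_separatingCoeff hp <| (sigmaSummable_iff _).2 <|
    hσ.summable_of_isEggSeries (hb.congr_ae hfσ.coeFn_toLp.symm)

end Comparison

end

theorem proposition5p2 (p : ℕ) (hp : 0 < p) :
    -- every admissible coefficient family gives a convergent series, and the sums are `𝔥²(𝓔ₚ, σ)`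
    ((∀ a : ℕ × ℕ → ℂ, SigmaSummable p a →
        ∃ f : Lp ℂ 2 (eggSigma p), IsEggSeries p (eggSigma p) a f) ∧
      hardySpace (egg p) (eggSigma p) =
        {f : Lp ℂ 2 (eggSigma p) | ∃ a : ℕ × ℕ → ℂ,
          SigmaSummable p a ∧ IsEggSeries p (eggSigma p) a f}) ∧
    -- the same for `𝔥²(𝓔ₚ, ωₚ)`
    ((∀ a : ℕ × ℕ → ℂ, OmegaSummable p a →
        ∃ f : Lp ℂ 2 (eggOmega p), IsEggSeries p (eggOmega p) a f) ∧
      hardySpace (egg p) (eggOmega p) =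
        {f : Lp ℂ 2 (eggOmega p) | ∃ a : ℕ × ℕ → ℂ,
          OmegaSummable p a ∧ IsEggSeries p (eggOmega p) a f}) ∧
    -- `σ` and `ωₚ` have the same null sets, so that the two spaces can be compared
    (eggSigma p ≪ eggOmega p ∧ eggOmega p ≪ eggSigma p) ∧
    (p = 1 → hardyFunctions (egg p) (eggSigma p) = hardyFunctions (egg p) (eggOmega p)) ∧
    (1 < p → hardyFunctions (egg p) (eggSigma p) ⊂ hardyFunctions (egg p) (eggOmega p)) := by
  have hσ := isEggMeasure_eggSigma hp
  have hω := isEggMeasure_eggOmega hp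
  have hle := dominatedBy_eggOmega_eggSigma hp
  refine ⟨⟨?_, ?_⟩, ⟨fun _ => hω.exists_isEggSeries, hω.hardySpace_eq⟩,
    ⟨eggSigma_absolutelyContinuous_eggOmega hp, hle.absolutelyContinuous⟩, ?_,
    hardyFunctions_ssubset⟩
  · exact fun a ha => hσ.exists_isEggSeries ((sigmaSummable_iff a).1 ha)
  · simp only [sigmaSummable_iff, hσ.hardySpace_eq]
  · rintro rfl
    exact (hσ.hardyFunctions_subset hω hle).antisymm
      (hω.hardyFunctions_subset hσ dominatedBy_eggSigma_one_eggOmega_one)
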